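/- **Model.** A circuit acts on an $n$-dimensional system register and on finitely many qubits. Its steps are arbitrary gates on at most two qubits (one time unit each) and calls to, or to the inverses of, given primitive operations, which are named unitaries on the system and some qubits (for example input oracles for $M$, or elementary gates on the system), each with a fixed cost that is a positive integer. The running time of a circuit is the sum of the costs of its steps. A $q$-qubit value register with a scale $C>0$ stores real numbers: with $Q=2^q$, the basis state $|l\rangle$ stands for $Cl/Q$ if $l<Q/2$ and for $-C(Q-l)/Q$ if $l\ge Q/2$. A basis state $|l\rangle$ of an $m$-qubit phase register stands for $l/2^m$. **Setting.** Let $M$ be an $n\times n$ normal matrix, $M=\sum_{j=1}^n\sigma_je^{2\pi i\theta_j}|u_j\rangle\langle u_j|$ with $\sigma_j\ge 0$, $\theta_j\in\mathbb R$ and $\{|u_j\rangle\}$ orthonormal, let $M=\sum_j\sigma_j|u_j\rangle\langle v_j|$ be a singular value decomposition with the same $\sigma_j,|u_j\rangle$, and let $|w_j^\pm\rangle=\frac1{\sqrt2}(|0\rangle|u_j\rangle\pm|1\rangle|v_j\rangle)$; these are eigenvectors of $\begin{pmatrix}0&M\\M^\dagger&0\end{pmatrix}$ with eigenvalues $\pm\sigma_j$.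 A circuit *performs quantum singular value estimation (QSVE) to precision $\epsilon_1$ with error $\eta$* if there are unit vectors $|S_j^\pm\rangle$ such that, for all coefficients $\beta_j^\pm\in\mathbb C$, it performs (work qubits start in $|0\rangle$ and, in the stated final state, are again in $|0\rangle$) $$\sum_j\bigl(\beta_j^+|w_j^+\rangle+\beta_j^-|w_j^-\rangle\bigr)|0\rangle\mapsto\sum_j\bigl(\beta_j^+|w_j^+\rangle|S_j^+\rangle+\beta_j^-|w_j^-\rangle|S_j^-\rangle\bigr)$$ up to an error of norm at most $\eta\|\beta\|$, where $|S_j^\pm\rangle$ is a superposition of basis states of the value register whose values are within $\epsilon_1$ of $\pm\sigma_j$ and are negative if and only if the eigenvalue $\pm\sigma_j$ is; for $\sigma_j=0$ the two eigenvalues coincide and $|S_j^+\rangle=|S_j^-\rangle$. (The states $|S_j^\pm\rangle$ are what is usually written $|{\pm\tilde\sigma_j}\rangle$; exact QSVE is the case $\eta=0$.) **Theorem.** For all $K,\delta>0$ there is a constant $B>0$, depending only on $K$ and $\delta$, with the following property. Let $\epsilon_1,\epsilon_2\in(0,1)$ and $T\in\mathbb R$, and let a circuit $\mathcal V$ (with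 one block qubit, a $q$-qubit value register and work qubits) of running time at most $KT/\epsilon_1$ be given. Then there is a circuit $\mathcal A$ (with a $q$-qubit value register, a phase register of some size $m$, the block qubit and work qubits), using the same primitive operations, of running time at most $$B\,\frac{T}{\epsilon_1\epsilon_2},$$ such that for every $n$, every interpretation of the primitive operations as unitaries, every $M,\sigma_j,\theta_j,|u_j\rangle,|v_j\rangle$ as above, every scale $C>0$ and every $\eta\ge0$: if $\mathcal V$ performs QSVE of $M$ to precision $\epsilon_1$ with error $\eta$, then $\mathcal A$ maps every $|b\rangle=\sum_j\beta_j|u_j\rangle$ (all its qubits starting in $|0\rangle$) to $$\sum_{j=1}^n\beta_j|u_j\rangle|\tilde\sigma_j\rangle|\tilde\theta_j\rangle$$ (block and work qubits again in $|0\rangle$) up to an error of norm at most $(\delta+B\eta/\epsilon_2)\|b\|$. Here, for each $j$, $|\tilde\sigma_j\rangle$ is a unit superposition of basis states of the value register whose values $\tilde\sigma$ all satisfy $|\tilde\sigma-\sigma_j|\le\epsilon_1$, and $|\tilde\theta_j\rangle$ is a unit vector of the phase register which, if $\sigma_j\ne0$, is a superposition of basis states whose values $\tilde\theta$ all satisfy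 $|\tilde\theta-\theta_j-z|\le\epsilon_2$ for some $z\in\mathbb Z$. In particular $\mathcal A$ depends neither on $|b\rangle$ nor on the eigen-decomposition of $M$. -/

import Mathlib

open scoped Kronecker

noncomputable section

namespace QEig

/-! Quantum circuits with a gate count.  The machine has one system register of dimension `n`,
with basis `Fin n`, and qubits indexed by a finite type `Q`. -/

/-- The names of the primitive operations through which an algorithm may touch the system
register (input oracles for the matrix, elementary gates on the system, and so on): the number
of qubits on which such an operation acts besides the system, and the time it takes, which is at
least one step. -/
structure Primitives where
  Op : Type
  arity : Op → ℕ
  time : Op → ℕ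
  one_le_time : ∀ o, 1 ≤ time o

/-- An interpretation of the primitive operations as unitaries on the `n`-dimensional system
together with `arity o` qubits. -/
abbrev Primitives.Interpretation (P : Primitives) (n : ℕ) : Type :=
  (o : P.Op) → Matrix.unitaryGroup (Fin n × (Fin (P.arity o) → Bool)) ℂ

/-- One step of a circuit on the system and the qubits `Q`: an arbitrary gate on at most two
qubits, or a primitive operation or its inverse; `e` says on which qubits it acts. -/
inductive Gate (P : Primitives) (Q : Type) : Type
  | elementary (k : ℕ) (hk : k ≤ 2) (G : Matrix.unitaryGroup (Fin k → Bool) ℂ) (e : Fin k ↪ Q)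
  | primitive (o : P.Op) (e : Fin (P.arity o) ↪ Q)
  | primitiveInv (o : P.Op) (e : Fin (P.arity o) ↪ Q)

/-- A circuit is a list of gates, the first gate being applied first.  It does not depend on the
interpretation of the primitive operations, nor on the dimension of the system. -/
abbrev Circuit (P : Primitives) (Q : Type) : Type := List (Gate P Q)

/-- The running time of a gate. -/
def Gate.time {P : Primitives} {Q : Type} : Gate P Q → ℕ
  | .elementary _ _ _ _ => 1
  | .primitive o _ => P.time o
  | .primitiveInv o _ => P.time o

/-- The running time of a circuit. -/
def Circuit.time {P : Primitives} {Q : Type} (c : Circuit P Q) : ℕ := (c.map Gate.time).sum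

/-- The operator `U` on the system and `k` qubits, applied to the system and the qubits
`e 0, …, e (k - 1)` of `Q`; it is the identity on the other qubits. -/
def place {n k : ℕ} {Q : Type} (U : Matrix (Fin n × (Fin k → Bool)) (Fin n × (Fin k → Bool)) ℂ)
    (e : Fin k ↪ Q) : Matrix (Fin n × (Q → Bool)) (Fin n × (Q → Bool)) ℂ :=
  open Classical in
  fun s t => if ∀ w, w ∉ Set.range e → s.2 w = t.2 w
    then U (s.1, fun i => s.2 (e i)) (t.1, fun i => t.2 (e i)) else 0

/-- The operator of a gate on the whole state space. -/
def Gate.mat {P : Primitives} {Q : Type} {n : ℕ} (I : P.Interpretation n) :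
    Gate P Q → Matrix (Fin n × (Q → Bool)) (Fin n × (Q → Bool)) ℂ
  | .elementary _ _ G e => place ((1 : Matrix (Fin n) (Fin n) ℂ) ⊗ₖ G.1) e
  | .primitive o e => place (I o).1 e
  | .primitiveInv o e => place (star (I o).1) e

/-- The final state of a circuit that is run on the state `ψ`. -/
def Circuit.run {P : Primitives} {Q : Type} [Fintype Q] [DecidableEq Q] {n : ℕ}
    (I : P.Interpretation n) (c : Circuit P Q) (ψ : EuclideanSpace ℂ (Fin n × (Q → Bool))) :
    EuclideanSpace ℂ (Fin n × (Q → Bool)) :=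
  c.foldl (fun φ g => WithLp.toLp 2 (Matrix.mulVec (g.mat I) φ.ofLp)) ψ

/-- The qubits of our circuits: one qubit for the two blocks of the Hermitian dilation, `q` qubits
for the estimates of the singular values, `m` qubits for the estimates of the phases, and `a`
work qubits. -/
inductive Wire (q m a : ℕ) : Type
  | block
  | sing (i : Fin q)
  | phase (i : Fin m)
  | work (i : Fin a)
  deriving DecidableEq, Fintype

/-- The integer in `{0, …, 2 ^ k - 1}` with the binary digits `x`. -/
def intValue {k : ℕ} (x : Fin k → Bool) : ℕ := ∑ i, if x i then 2 ^ (i : ℕ) else 0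

/-- The real number in the singular value register: with `Q = 2 ^ q`, the integer `l` stands for
`C * l / Q` if `l < Q / 2`, and for `-C * (Q - l) / Q` otherwise. -/
def signedValue (C : ℝ) {q : ℕ} (x : Fin q → Bool) : ℝ :=
  if 2 * intValue x < 2 ^ q then C * (intValue x / 2 ^ q)
  else -(C * ((2 ^ q - intValue x) / 2 ^ q))

/-- The number in `[0, 1)` in the phase register. -/
def phaseValue {m : ℕ} (y : Fin m → Bool) : ℝ := intValue y / 2 ^ m

/-- The state `|0 ⋯ 0⟩` of `k` qubits. -/
def zeroKet (k : ℕ) : EuclideanSpace ℂ (Fin k → Bool) :=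
  EuclideanSpace.single (fun _ => false) 1

/-- The state with `|0⟩|a⟩ + |1⟩|b⟩` in the block qubit and the system, `S` in the singular value
register, `Θ` in the phase register, and all work qubits in the state `|0⟩`. -/
def registerState {n q m : ℕ} (w : ℕ) (a b : EuclideanSpace ℂ (Fin n))
    (S : EuclideanSpace ℂ (Fin q → Bool)) (Θ : EuclideanSpace ℂ (Fin m → Bool)) :
    EuclideanSpace ℂ (Fin n × (Wire q m w → Bool)) :=
  WithLp.toLp 2 fun s =>
    (if s.2 .block then b s.1 else a s.1) * S (fun i => s.2 (.sing i)) *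
      Θ (fun i => s.2 (.phase i)) * zeroKet w (fun i => s.2 (.work i))

/-- The sign `+1` or `-1`. -/
def sgn (s : Bool) : ℝ := if s then 1 else -1

/-- `M = ∑ j, σ j * exp (2πi θ j) |u j⟩⟨u j|` with `σ j ≥ 0` and an orthonormal basis `u`. -/
structure IsEigenDecomposition {n : ℕ} (M : Matrix (Fin n) (Fin n) ℂ) (σ θ : Fin n → ℝ)
    (u : Fin n → EuclideanSpace ℂ (Fin n)) : Prop where
  nonneg : ∀ j, 0 ≤ σ j
  orthonormal : Orthonormal ℂ u
  eq_sum : ∀ r c, M r c =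
    ∑ j, (σ j : ℂ) * Complex.exp (2 * Real.pi * Complex.I * (θ j : ℂ)) * (u j r * star (u j c))

/-- `M = ∑ j, σ j |u j⟩⟨v j|` with `σ j ≥ 0` and orthonormal bases `u`, `v`. -/
structure IsSVD {n : ℕ} (M : Matrix (Fin n) (Fin n) ℂ) (σ : Fin n → ℝ)
    (u v : Fin n → EuclideanSpace ℂ (Fin n)) : Prop where
  nonneg : ∀ j, 0 ≤ σ j
  orthonormal_left : Orthonormal ℂ u
  orthonormal_right : Orthonormal ℂ v
  eq_sum : ∀ r c, M r c = ∑ j, (σ j : ℂ) * (u j r * star (v j c))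

/-- Quantum singular value estimation to precision `ε`, up to an error `η` in norm: on the
eigenvectors `w j s = (|0⟩|u j⟩ + s |1⟩|v j⟩) / √2` of the Hermitian dilation, `s = ±1`, with
eigenvalues `s * σ j`, the circuit performs
`∑ β j s |w j s⟩|0⟩ ↦ ∑ β j s |w j s⟩|S j s⟩`, where the state `|S j s⟩` of the singular value
register is a superposition of `ε`-approximations of `s * σ j` which are negative if
and only if `s * σ j` is.  For `σ j = 0` the two eigenvalues coincide, and so do the estimates. -/
def ImplementsQSVE {P : Primitives} {n q a : ℕ} (I : P.Interpretation n)
    (c : Circuit P (Wire q 0 a)) (C : ℝ) (σ : Fin n → ℝ)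
    (u v : Fin n → EuclideanSpace ℂ (Fin n)) (ε η : ℝ) : Prop :=
  ∃ S : Fin n → Bool → EuclideanSpace ℂ (Fin q → Bool),
    (∀ j s, ‖S j s‖ = 1) ∧
    (∀ j s x, S j s x ≠ 0 → |signedValue C x - sgn s * σ j| ≤ ε ∧
      (signedValue C x < 0 ↔ sgn s * σ j < 0)) ∧
    (∀ j, σ j = 0 → S j true = S j false) ∧
    ∀ β : EuclideanSpace ℂ (Fin n × Bool),
      ‖c.run I (∑ j, ∑ s, (β (j, s) * (1 / Real.sqrt 2 : ℝ)) •
            registerState a (u j) ((sgn s : ℂ) • v j) (zeroKet q) (zeroKet 0)) -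
          ∑ j, ∑ s, (β (j, s) * (1 / Real.sqrt 2 : ℝ)) •
            registerState a (u j) ((sgn s : ℂ) • v j) (S j s) (zeroKet 0)‖ ≤ η * ‖β‖

/-- Eigenvalue estimation for a normal matrix, up to an error `η` in norm: the circuit performs
`∑ β j |u j⟩|0⟩|0⟩ ↦ ∑ β j |u j⟩|S j⟩|Θ j⟩`, where `|S j⟩` is a superposition of
`ε₁`-approximations of the singular value `σ j` and `|Θ j⟩`, if `σ j ≠ 0`, a superposition of
`ε₂`-approximations of the phase `θ j` modulo `1`. -/
def ImplementsEigenvalueEstimation {P : Primitives} {n q m a : ℕ} (I : P.Interpretation n)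
    (c : Circuit P (Wire q m a)) (C : ℝ) (σ θ : Fin n → ℝ)
    (u : Fin n → EuclideanSpace ℂ (Fin n)) (ε₁ ε₂ η : ℝ) : Prop :=
  ∃ (S : Fin n → EuclideanSpace ℂ (Fin q → Bool)) (Θ : Fin n → EuclideanSpace ℂ (Fin m → Bool)),
    (∀ j, ‖S j‖ = 1 ∧ ∀ x, S j x ≠ 0 → |signedValue C x - σ j| ≤ ε₁) ∧
    (∀ j, ‖Θ j‖ = 1 ∧
      (σ j ≠ 0 → ∀ y, Θ j y ≠ 0 → ∃ z : ℤ, |phaseValue y - θ j - z| ≤ ε₂)) ∧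
    ∀ β : EuclideanSpace ℂ (Fin n),
      ‖c.run I (registerState a (∑ j, β j • u j) 0 (zeroKet q) (zeroKet m)) -
          ∑ j, β j • registerState a (u j) 0 (S j) (Θ j)‖ ≤ η * ‖β‖

end QEig

end

open scoped Kronecker

noncomputable section

namespace QEig

open Function

/-! ### Operators placed on a subset of the qubits. -/

section Place

variable {n k : ℕ} {Q : Type} [Fintype Q] [DecidableEq Q]

/-! Write `ζ j` for `exp (2πi θ j)`. Where `σ j ≠ 0`, comparing the two decompositions of `M` gives
`v j = star (ζ j) • u j` (`IsSVD.right_eq`), so `|0⟩|u j⟩` and `|1⟩|u j⟩` span the same plane as the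
two eigenvectors `w j ±` of the dilation. Singular value estimation shows the sign of the eigenvalue
in the top digit of its register. Estimating, changing the sign of the amplitude on that digit and
undoing the estimate is therefore, up to `2η`, the reflection `w j ± ↦ ± w j ±`, that is, `|0⟩|u j⟩
↦ star (ζ j) |1⟩|u j⟩` and `|1⟩|u j⟩ ↦ ζ j |0⟩|u j⟩` (`EstimatesSign.approx_reflC`). A NOT on the
block qubit followed by this reflection multiplies `|0⟩|u j⟩` by `ζ j`. Only signs are used here, so
the precision of the phase is limited by the number of repetitions alone.

The kernel needs care: for `σ j = 0` the reflection fixes `|0⟩|u j⟩`, nothing relates `v j` to `u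
j`, and a NOT would not be undone. So a flag first records whether the reflection flips the block
qubit, the NOT is controlled by the flag, and the flag is erased at the end; kernel vectors get the
phase `1` (`EstimatesSign.approx_ctrlPhaseC`).

With controlled powers of `ζ j` available, phase estimation on `m` qubits applies. Its amplitudes
are products that telescope to a geometric sum, and the weight of the outcomes at distance more than
`ε₂` from `θ j` is at most `1 / L` if `L ≤ 2 ^ m * ε₂` (`sum_norm_phaseAmp_sq_le`). Removing these
outcomes and renormalizing gives the states `Θ j` at a cost `δ`. The power `2 ^ m` is of order `1 /
ε₂`, whence the running time and, since errors of unitary steps add up, the error of order `η / ε₂`.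

For the singular value, a Hadamard gate and one controlled reflection turn `|0⟩|u j⟩` into `w j +`;
one run of the estimation writes `S j +` into the register, and the preparation is undone
(`EstimatesSign.approx_appendC`).

States are written as `st u χ`, with a coefficient function `χ j` on bit strings for each `j`. Every
ideal step acts on each `χ j` separately, so the algorithm reduces to identities between coefficient
functions. -/

lemma place_mulVec (U : Matrix (Fin n × (Fin k → Bool)) (Fin n × (Fin k → Bool)) ℂ) (e : Fin k ↪ Q)
    (ψ : Fin n × (Q → Bool) → ℂ) (s : Fin n) (x : Q → Bool) :
    (place U e).mulVec ψ (s, x) =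
      ∑ t : Fin n × (Fin k → Bool), U (s, x ∘ e) t * ψ (t.1, extend e t.2 x) := by
  classical
  rw [Matrix.mulVec, dotProduct]
  symm
  refine Finset.sum_of_injOn (fun t => (t.1, extend e t.2 x)) ?_ (by simp [Set.MapsTo]) ?_ ?_
  · rintro ⟨a, z⟩ _ ⟨b, z'⟩ _ h
    simp only [Prod.mk.injEq] at h ⊢
    refine ⟨h.1, funext fun i => ?_⟩
    have := congrFun h.2 (e i)
    rwa [e.injective.extend_apply, e.injective.extend_apply] at this
  · rintro ⟨a, y⟩ _ h
    simp only [place]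
    rw [if_neg, zero_mul]
    intro hy
    apply h
    refine ⟨(a, y ∘ e), by simp, ?_⟩
    simp only [Prod.mk.injEq, true_and]
    funext w
    by_cases hw : ∃ i, e i = w
    · obtain ⟨i, rfl⟩ := hw
      rw [e.injective.extend_apply]; rfl
    · rw [extend_apply' _ _ _ hw]
      exact hy w (by simpa using hw)
  · rintro ⟨a, z⟩ _
    simp only [place]
    rw [if_pos]
    · congr 3
      funext i
      simp [e.injective.extend_apply]
    · intro w hw
      rw [extend_apply']
      simpa using hw

lemma extend_comp_embedding {α β : Type*} (e : α ↪ β) (z : α → Bool) (x : β → Bool) :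
    extend e z x ∘ e = z := Function.extend_comp e.injective z x

lemma extend_extend_self {α β : Type*} (e : α ↪ β) (z z' : α → Bool) (x : β → Bool) :
    extend e z (extend e z' x) = extend e z x := by
  funext w
  by_cases hw : ∃ i, e i = w
  · obtain ⟨i, rfl⟩ := hw
    simp [e.injective.extend_apply]
  · simp [extend_apply' _ _ _ hw]

lemma extend_self_comp {α β : Type*} (e : α ↪ β) (x : β → Bool) :
    extend e (x ∘ e) x = x := by
  funext w
  by_cases hw : ∃ i, e i = w
  · obtain ⟨i, rfl⟩ := hw
    simp [e.injective.extend_apply]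
  · simp [extend_apply' _ _ _ hw]

lemma place_mulVec_place_mulVec
    (U V : Matrix (Fin n × (Fin k → Bool)) (Fin n × (Fin k → Bool)) ℂ) (e : Fin k ↪ Q)
    (ψ : Fin n × (Q → Bool) → ℂ) :
    (place U e).mulVec ((place V e).mulVec ψ) = (place (U * V) e).mulVec ψ := by
  funext ⟨s, x⟩
  simp only [place_mulVec, extend_comp_embedding, extend_extend_self, Matrix.mul_apply,
    Finset.mul_sum, Finset.sum_mul, mul_assoc]
  rw [Finset.sum_comm]

lemma place_one_mulVec (e : Fin k ↪ Q) (ψ : Fin n × (Q → Bool) → ℂ) :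
    (place 1 e).mulVec ψ = ψ := by
  funext ⟨s, x⟩
  simp [place_mulVec, Matrix.one_apply, extend_self_comp]

lemma norm_toLp_mulVec {ι : Type*} [Fintype ι] [DecidableEq ι] {U : Matrix ι ι ℂ}
    (hU : U ∈ Matrix.unitaryGroup ι ℂ) (x : ι → ℂ) :
    ‖WithLp.toLp 2 (U.mulVec x)‖ = ‖WithLp.toLp 2 x‖ := by
  have key : ∀ y : ι → ℂ, ((‖WithLp.toLp 2 y‖ ^ 2 : ℝ) : ℂ) = star y ⬝ᵥ y := by
    intro y
    rw [EuclideanSpace.norm_sq_eq, dotProduct]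
    push_cast
    refine Finset.sum_congr rfl fun i _ => ?_
    simp [Complex.conj_mul']
  have h : (‖WithLp.toLp 2 (U.mulVec x)‖ ^ 2 : ℝ) = ‖WithLp.toLp 2 x‖ ^ 2 := by
    apply Complex.ofReal_injective
    rw [key, key, Matrix.star_mulVec, Matrix.dotProduct_mulVec, Matrix.vecMul_vecMul,
      ← Matrix.star_eq_conjTranspose, (Matrix.mem_unitaryGroup_iff').1 hU, Matrix.vecMul_one]
  exact (pow_left_inj₀ (norm_nonneg _) (norm_nonneg _) two_ne_zero).1 h

lemma place_conjTranspose (U : Matrix (Fin n × (Fin k → Bool)) (Fin n × (Fin k → Bool)) ℂ)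
    (e : Fin k ↪ Q) : (place U e).conjTranspose = place U.conjTranspose e := by
  ext s t
  simp only [place, Matrix.conjTranspose_apply]
  split_ifs with h₁ h₂ h₂
  · rfl
  · exact absurd (fun w hw => (h₁ w hw).symm) h₂
  · exact absurd (fun w hw => (h₂ w hw).symm) h₁
  · simp

lemma place_mem_unitaryGroup {U : Matrix (Fin n × (Fin k → Bool)) (Fin n × (Fin k → Bool)) ℂ}
    (hU : U ∈ Matrix.unitaryGroup _ ℂ) (e : Fin k ↪ Q) :
    place U e ∈ Matrix.unitaryGroup (Fin n × (Q → Bool)) ℂ := by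
  rw [Matrix.mem_unitaryGroup_iff', Matrix.star_eq_conjTranspose, place_conjTranspose]
  apply Matrix.ext_of_mulVec_single
  intro i
  rw [← Matrix.mulVec_mulVec, place_mulVec_place_mulVec, ← Matrix.star_eq_conjTranspose,
    (Matrix.mem_unitaryGroup_iff').1 hU, place_one_mulVec, Matrix.one_mulVec]

end Place

/-! ### Inverse circuits, renamed qubits, and slices of a state. -/

section Circuits

variable {P : Primitives} {Q Q' : Type}

/-- The inverse gate. -/
def Gate.inv : Gate P Q → Gate P Q
  | .elementary k hk G e => .elementary k hk (star G) e
  | .primitive o e => .primitiveInv o e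
  | .primitiveInv o e => .primitive o e

/-- The inverse circuit. -/
def Circuit.inv (c : Circuit P Q) : Circuit P Q := (c.map Gate.inv).reverse

/-- The same gate on renamed qubits. -/
def Gate.rename (ρ : Q ↪ Q') : Gate P Q → Gate P Q'
  | .elementary k hk G e => .elementary k hk G (e.trans ρ)
  | .primitive o e => .primitive o (e.trans ρ)
  | .primitiveInv o e => .primitiveInv o (e.trans ρ)

/-- The same circuit on renamed qubits. -/
def Circuit.rename (ρ : Q ↪ Q') (c : Circuit P Q) : Circuit P Q' := c.map (Gate.rename ρ)

lemma Circuit.time_append (c d : Circuit P Q) :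
    Circuit.time (c ++ d) = Circuit.time c + Circuit.time d := by
  simp [Circuit.time]

lemma Circuit.time_cons (g : Gate P Q) (d : Circuit P Q) :
    Circuit.time (g :: d) = g.time + Circuit.time d := by
  simp [Circuit.time]

@[simp] lemma Circuit.time_nil : Circuit.time ([] : Circuit P Q) = 0 := rfl

lemma Circuit.time_inv (c : Circuit P Q) : Circuit.time c.inv = Circuit.time c := by
  simp only [Circuit.time, Circuit.inv, List.map_reverse, List.sum_reverse, List.map_map]
  congr 2
  funext g
  cases g <;> rfl

lemma Circuit.time_rename (ρ : Q ↪ Q') (c : Circuit P Q) :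
    Circuit.time (c.rename ρ) = Circuit.time c := by
  simp only [Circuit.time, Circuit.rename, List.map_map]
  congr 2
  funext g
  cases g <;> rfl

lemma Gate.one_le_time (g : Gate P Q) : 1 ≤ g.time := by
  cases g
  · exact le_rfl
  · exact P.one_le_time _
  · exact P.one_le_time _

variable {n : ℕ} [Fintype Q] [DecidableEq Q] [Fintype Q'] [DecidableEq Q']
  (I : P.Interpretation n)

lemma kronecker_mem_unitary' {k : ℕ} (G : Matrix.unitaryGroup (Fin k → Bool) ℂ) :
    (1 : Matrix (Fin n) (Fin n) ℂ) ⊗ₖ G.1 ∈ Matrix.unitaryGroup (Fin n × (Fin k → Bool)) ℂ := by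
  rw [Matrix.mem_unitaryGroup_iff', Matrix.star_eq_conjTranspose, Matrix.conjTranspose_kronecker,
    ← Matrix.mul_kronecker_mul, ← Matrix.star_eq_conjTranspose G.1,
    (Matrix.mem_unitaryGroup_iff').1 G.2]
  simp

lemma Gate.mat_mem (g : Gate P Q) : g.mat I ∈ Matrix.unitaryGroup (Fin n × (Q → Bool)) ℂ := by
  cases g with
  | elementary k hk G e => exact place_mem_unitaryGroup (kronecker_mem_unitary' G) e
  | primitive o e => exact place_mem_unitaryGroup (I o).2 e
  | primitiveInv o e => exact place_mem_unitaryGroup (star (I o)).2 e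

lemma Gate.mat_inv (g : Gate P Q) : g.inv.mat I = star (g.mat I) := by
  rw [Matrix.star_eq_conjTranspose]
  cases g with
  | elementary k hk G e =>
    simp only [Gate.inv, Gate.mat, place_conjTranspose, Matrix.conjTranspose_kronecker]
    simp [Matrix.star_eq_conjTranspose]
  | primitive o e => simp [Gate.inv, Gate.mat, place_conjTranspose, Matrix.star_eq_conjTranspose]
  | primitiveInv o e =>
    simp [Gate.inv, Gate.mat, place_conjTranspose, Matrix.star_eq_conjTranspose]

/-- The states of the machine. -/
abbrev St (n : ℕ) (Q : Type) : Type := EuclideanSpace ℂ (Fin n × (Q → Bool))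

/-- The action of one gate. -/
def Gate.act (g : Gate P Q) (ψ : St n Q) : St n Q :=
  WithLp.toLp 2 (Matrix.mulVec (g.mat I) ψ.ofLp)

@[simp] lemma Circuit.run_nil (ψ : St n Q) : Circuit.run I ([] : Circuit P Q) ψ = ψ := rfl

lemma Circuit.run_cons (g : Gate P Q) (c : Circuit P Q) (ψ : St n Q) :
    Circuit.run I (g :: c) ψ = Circuit.run I c (g.act I ψ) := rfl

lemma Circuit.run_append (c d : Circuit P Q) (ψ : St n Q) :
    Circuit.run I (c ++ d) ψ = Circuit.run I d (Circuit.run I c ψ) := by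
  simp [Circuit.run, List.foldl_append]

lemma Gate.act_sub (g : Gate P Q) (φ ψ : St n Q) : g.act I (φ - ψ) = g.act I φ - g.act I ψ := by
  simp [Gate.act, Matrix.mulVec_sub]

lemma Gate.norm_act (g : Gate P Q) (ψ : St n Q) : ‖g.act I ψ‖ = ‖ψ‖ :=
  norm_toLp_mulVec (g.mat_mem I) _

lemma Gate.act_inv_act (g : Gate P Q) (ψ : St n Q) : g.inv.act I (g.act I ψ) = ψ := by
  simp [Gate.act, Gate.mat_inv, Matrix.mulVec_mulVec,
    (Matrix.mem_unitaryGroup_iff').1 (g.mat_mem I)]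

lemma Circuit.run_sub (c : Circuit P Q) (φ ψ : St n Q) :
    c.run I (φ - ψ) = c.run I φ - c.run I ψ := by
  induction c generalizing φ ψ with
  | nil => rfl
  | cons g c ih => rw [Circuit.run_cons, Gate.act_sub, ih]; rfl

lemma Circuit.norm_run (c : Circuit P Q) (ψ : St n Q) : ‖c.run I ψ‖ = ‖ψ‖ := by
  induction c generalizing ψ with
  | nil => rfl
  | cons g c ih => rw [Circuit.run_cons, ih, Gate.norm_act]

lemma Circuit.run_inv_run (c : Circuit P Q) (ψ : St n Q) : c.inv.run I (c.run I ψ) = ψ := by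
  induction c generalizing ψ with
  | nil => rfl
  | cons g c ih =>
    have : Circuit.inv (g :: c) = Circuit.inv c ++ [g.inv] := by simp [Circuit.inv]
    rw [this, Circuit.run_append, Circuit.run_cons I g c, ih]
    exact Gate.act_inv_act I g ψ

/-- The part of a state in which the qubits outside the range of `ρ` have the values `x`. -/
def slice (ρ : Q ↪ Q') (x : Q' → Bool) (Ψ : St n Q') : St n Q :=
  WithLp.toLp 2 fun t => Ψ (t.1, extend ρ t.2 x)

lemma extend_trans {α β γ : Type*} (e : α ↪ β) (ρ : β ↪ γ) (z : α → Bool) (y : β → Bool)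
    (x : γ → Bool) : extend (e.trans ρ) z (extend ρ y x) = extend ρ (extend e z y) x := by
  funext w
  by_cases hw : ∃ i, ρ i = w
  · obtain ⟨i, rfl⟩ := hw
    rw [ρ.injective.extend_apply]
    by_cases hi : ∃ l, e l = i
    · obtain ⟨l, rfl⟩ := hi
      rw [e.injective.extend_apply]
      exact (e.trans ρ).injective.extend_apply z _ l
    · rw [extend_apply' _ _ _ hi, extend_apply', ρ.injective.extend_apply]
      rintro ⟨l, hl⟩
      exact hi ⟨l, ρ.injective hl⟩
  · rw [extend_apply', extend_apply' _ _ _ hw, extend_apply' _ _ _ hw]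
    rintro ⟨l, hl⟩
    exact hw ⟨e l, hl⟩

lemma slice_place {k : ℕ} (U : Matrix (Fin n × (Fin k → Bool)) (Fin n × (Fin k → Bool)) ℂ)
    (e : Fin k ↪ Q) (ρ : Q ↪ Q') (x : Q' → Bool) (Ψ : St n Q') :
    slice ρ x (WithLp.toLp 2 ((place U (e.trans ρ)).mulVec Ψ.ofLp)) =
      WithLp.toLp 2 ((place U e).mulVec (slice ρ x Ψ).ofLp) := by
  ext ⟨s, y⟩
  simp only [slice, place_mulVec, extend_trans]
  refine Finset.sum_congr rfl fun t _ => ?_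
  congr 3
  funext i
  simp [ρ.injective.extend_apply]

/-- The qubits outside the range of `ρ` are spectators, so the circuit acts on each slice as it does
on the small machine. This transfers the assumption on singular value estimation to a larger
machine. -/
lemma slice_run (ρ : Q ↪ Q') (x : Q' → Bool) (c : Circuit P Q) (Ψ : St n Q') :
    slice ρ x ((c.rename ρ).run I Ψ) = c.run I (slice ρ x Ψ) := by
  induction c generalizing Ψ with
  | nil => rfl
  | cons g c ih =>
    have h : slice ρ x ((g.rename ρ).act I Ψ) = g.act I (slice ρ x Ψ) := by
      cases g <;> exact slice_place _ _ _ _ _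
    have : Circuit.rename ρ (g :: c) = g.rename ρ :: Circuit.rename ρ c := rfl
    rw [this, Circuit.run_cons, ih, h, Circuit.run_cons]

/-- Exchanging `y` with the part of `x` on the range of `ρ` is an involution of the pairs `(x, y)`.
-/
lemma sum_extend {R : Type*} [CommSemiring R] (ρ : Q ↪ Q')
    (F : (Q' → Bool) → R) :
    ∑ x : Q' → Bool, ∑ y : Q → Bool, F (extend ρ y x) =
      (Fintype.card (Q → Bool) : R) * ∑ x, F x := by
  rw [← Fintype.sum_prod_type' (f := fun x y => F (extend ρ y x))]
  have hinv : Function.Involutive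
      (fun p : (Q' → Bool) × (Q → Bool) => (extend ρ p.2 p.1, p.1 ∘ ρ)) := by
    rintro ⟨x, y⟩
    simp [extend_extend_self, extend_self_comp, extend_comp_embedding]
  have := Equiv.sum_comp hinv.toPerm (fun p => F p.1)
  simp only [Function.Involutive.coe_toPerm] at this
  rw [this, Fintype.sum_prod_type]
  simp [Finset.mul_sum]

lemma sum_norm_slice_sq (ρ : Q ↪ Q') (Ψ : St n Q') :
    ∑ x, ‖slice ρ x Ψ‖ ^ 2 = (Fintype.card (Q → Bool) : ℝ) * ‖Ψ‖ ^ 2 := by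
  simp only [EuclideanSpace.norm_sq_eq, slice, Fintype.sum_prod_type]
  rw [Finset.sum_comm]
  rw [Finset.mul_sum]
  exact Finset.sum_congr rfl fun s _ => sum_extend ρ (fun x => ‖Ψ (s, x)‖ ^ 2)

end Circuits

/-! ### Composition of approximate steps. -/

section Approx

variable {P : Primitives} {Q : Type} [Fintype Q] [DecidableEq Q] {n : ℕ} (I : P.Interpretation n)

/-- The circuit `c` maps `Ψ` to `Ψ'`, a vector of the same norm, up to a relative error `e`. -/
def Approx (c : Circuit P Q) (e : ℝ) (Ψ Ψ' : St n Q) : Prop :=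
  ‖c.run I Ψ - Ψ'‖ ≤ e * ‖Ψ‖ ∧ ‖Ψ'‖ = ‖Ψ‖

variable {I}

/-- The second circuit is unitary and does not enlarge the first error; equality of the norms lets
the relative errors be added. -/
lemma Approx.append {c d : Circuit P Q} {e e' : ℝ} {Ψ Ψ' Ψ'' : St n Q} (h : Approx I c e Ψ Ψ')
    (h' : Approx I d e' Ψ' Ψ'') : Approx I (c ++ d) (e + e') Ψ Ψ'' := by
  refine ⟨?_, h'.2.trans h.2⟩
  have h₁ : ‖d.run I (c.run I Ψ) - d.run I Ψ'‖ ≤ e * ‖Ψ‖ := by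
    rw [← Circuit.run_sub, Circuit.norm_run]
    exact h.1
  have h₂ := h'.1
  rw [h.2] at h₂
  rw [Circuit.run_append, add_mul]
  exact (norm_sub_le_norm_sub_add_norm_sub _ (d.run I Ψ') _).trans (add_le_add h₁ h₂)

lemma Approx.inv {c : Circuit P Q} {e : ℝ} {Ψ Ψ' : St n Q} (h : Approx I c e Ψ Ψ') :
    Approx I c.inv e Ψ' Ψ := by
  refine ⟨?_, h.2.symm⟩
  rw [h.2, ← Circuit.run_inv_run I c Ψ, ← Circuit.run_sub, Circuit.norm_run, norm_sub_rev,
    Circuit.run_inv_run]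
  exact h.1

lemma Approx.mono {c : Circuit P Q} {e e' : ℝ} {Ψ Ψ' : St n Q} (h : Approx I c e Ψ Ψ')
    (he : e ≤ e') : Approx I c e' Ψ Ψ' :=
  ⟨h.1.trans (by gcongr), h.2⟩

lemma Approx.of_eq {c : Circuit P Q} {e e' : ℝ} {Ψ Ψ' Ψ'' : St n Q} (h : Approx I c e Ψ Ψ')
    (he : e = e') (hΨ : Ψ' = Ψ'') : Approx I c e' Ψ Ψ'' := by
  rwa [← he, ← hΨ]

lemma approx_nil (Ψ : St n Q) : Approx I [] 0 Ψ Ψ := by simp [Approx]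

lemma approx_of_run_eq {c : Circuit P Q} {Ψ Ψ' : St n Q} (h : c.run I Ψ = Ψ') :
    Approx I c 0 Ψ Ψ' := by
  refine ⟨by simp [h], ?_⟩
  rw [← h, Circuit.norm_run]

end Approx

/-! ### Hadamard, controlled NOT and controlled phase on coefficient functions. -/

section Elementary

variable {P : Primitives} {Q : Type} {n : ℕ}

/-- The state `∑ j, |u j⟩|χ j⟩` of the machine. -/
def st (u : Fin n → EuclideanSpace ℂ (Fin n)) (χ : Fin n → (Q → Bool) → ℂ) : St n Q :=
  WithLp.toLp 2 fun t => ∑ j, χ j t.2 * u j t.1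

/-- The Hadamard matrix. -/
def hadamardMatrix : Matrix (Fin 1 → Bool) (Fin 1 → Bool) ℂ :=
  fun a b => (if a 0 && b 0 then -1 else 1) / (Real.sqrt 2 : ℂ)

lemma sum_fin_one_bool {R : Type*} [AddCommMonoid R] (f : (Fin 1 → Bool) → R) :
    ∑ z, f z = f (fun _ => false) + f (fun _ => true) := by
  rw [← Equiv.sum_comp (Equiv.funUnique (Fin 1) Bool).symm f, Fintype.sum_bool, add_comm]
  rfl

lemma sqrt_two_mul_self : (Real.sqrt 2 : ℂ) * (Real.sqrt 2 : ℂ) = 2 := by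
  rw [← Complex.ofReal_mul, Real.mul_self_sqrt zero_le_two]; norm_num

lemma hadamardMatrix_mem : hadamardMatrix ∈ Matrix.unitaryGroup (Fin 1 → Bool) ℂ := by
  rw [Matrix.mem_unitaryGroup_iff]
  have h2 : (Real.sqrt 2 : ℂ) ≠ 0 := by simp
  ext a b
  have ha : a = fun _ => a 0 := funext fun i => by rw [Subsingleton.elim i 0]
  have hb : b = fun _ => b 0 := funext fun i => by rw [Subsingleton.elim i 0]
  have hab : a = b ↔ a 0 = b 0 := ⟨fun h => by rw [h], fun h => by rw [ha, hb, h]⟩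
  rw [Matrix.mul_apply, sum_fin_one_bool, Matrix.one_apply]
  simp only [hadamardMatrix, Matrix.star_apply, hab]
  cases a 0 <;> cases b 0 <;> simp [Complex.conj_ofReal] <;> field_simp <;>
    simp [pow_two, sqrt_two_mul_self] <;> norm_num

/-- The permutation matrix of an involution. -/
def involutionMatrix {ι : Type*} [DecidableEq ι] (τ : ι → ι) : Matrix ι ι ℂ :=
  fun a b => if b = τ a then 1 else 0

lemma involutionMatrix_mem {ι : Type*} [Fintype ι] [DecidableEq ι] {τ : ι → ι}
    (hτ : Function.Involutive τ) : involutionMatrix τ ∈ Matrix.unitaryGroup ι ℂ := by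
  rw [Matrix.mem_unitaryGroup_iff]
  ext a b
  rw [Matrix.mul_apply, Matrix.one_apply]
  simp [involutionMatrix, Matrix.star_apply, hτ.injective.eq_iff, apply_ite, eq_comm]

/-- The permutation of a controlled NOT. -/
def cnotPerm (a : Fin 2 → Bool) : Fin 2 → Bool := update a 1 (xor (a 1) (a 0))

lemma cnotPerm_involutive : Function.Involutive cnotPerm := by
  unfold Function.Involutive cnotPerm
  decide

/-- The matrix of a controlled phase. -/
def cphaseMatrix (ζ : ℂ) : Matrix (Fin 2 → Bool) (Fin 2 → Bool) ℂ :=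
  Matrix.diagonal fun a => if a 0 && a 1 then ζ else 1

lemma cphaseMatrix_mem {ζ : ℂ} (hζ : ‖ζ‖ = 1) :
    cphaseMatrix ζ ∈ Matrix.unitaryGroup (Fin 2 → Bool) ℂ := by
  rw [Matrix.mem_unitaryGroup_iff, cphaseMatrix, Matrix.star_eq_conjTranspose,
    Matrix.diagonal_conjTranspose, Matrix.diagonal_mul_diagonal, ← Matrix.diagonal_one]
  congr 1
  funext a
  simp only [Pi.star_apply]
  split_ifs
  · simp [Complex.mul_conj', hζ]
  · simp

/-- Two different qubits. -/
def pairEmb (c t : Q) (h : c ≠ t) : Fin 2 ↪ Q :=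
  ⟨![c, t], by
    intro i j
    fin_cases i <;> fin_cases j <;> simp [h, h.symm]⟩

/-- A Hadamard gate on the qubit `w`. -/
def hadC (w : Q) : Circuit P Q :=
  [.elementary 1 (by norm_num) ⟨hadamardMatrix, hadamardMatrix_mem⟩
    ⟨fun _ => w, fun _ _ _ => Subsingleton.elim _ _⟩]

open Classical in
/-- A controlled NOT with control `c` and target `t ≠ c`. -/
def cnotC (c t : Q) : Circuit P Q :=
  if h : c ≠ t then
    [.elementary 2 le_rfl ⟨involutionMatrix cnotPerm, involutionMatrix_mem cnotPerm_involutive⟩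
      (pairEmb c t h)]
  else []

open Classical in
/-- A controlled phase `ζ` on the qubits `c ≠ t`. -/
def cphaseC (ζ : ℂ) (c t : Q) : Circuit P Q :=
  if h : c ≠ t ∧ ‖ζ‖ = 1 then
    [.elementary 2 le_rfl ⟨cphaseMatrix ζ, cphaseMatrix_mem h.2⟩ (pairEmb c t h.1)]
  else []

lemma time_hadC (w : Q) : Circuit.time (hadC w : Circuit P Q) = 1 := rfl

lemma time_cnotC (c t : Q) : Circuit.time (cnotC c t : Circuit P Q) ≤ 1 := by
  unfold cnotC
  split_ifs <;> simp [Circuit.time, Gate.time]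

lemma time_cphaseC (ζ : ℂ) (c t : Q) : Circuit.time (cphaseC ζ c t : Circuit P Q) ≤ 1 := by
  unfold cphaseC
  split_ifs <;> simp [Circuit.time, Gate.time]

variable (u : Fin n → EuclideanSpace ℂ (Fin n)) (χ : Fin n → (Q → Bool) → ℂ)

lemma st_sub (χ' : Fin n → (Q → Bool) → ℂ) : st u χ - st u χ' = st u (χ - χ') := by
  ext t
  simp [st, sub_mul]

lemma slice_st {Q' : Type} (ρ : Q ↪ Q')
    (χ : Fin n → (Q' → Bool) → ℂ) (x : Q' → Bool) :
    slice ρ x (st u χ) = st u fun j y => χ j (extend ρ y x) := rfl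

lemma extend_const [DecidableEq Q] (w : Q) (b : Bool) (x : Q → Bool) :
    extend (fun _ : Fin 1 => w) (fun _ => b) x = update x w b := by
  funext i
  by_cases h : i = w
  · subst h
    rw [update_self]
    exact Function.Injective.extend_apply (fun _ _ _ => Subsingleton.elim _ _) _ _ (0 : Fin 1)
  · rw [update_of_ne h, extend_apply']
    simpa using Ne.symm h

lemma extend_pairEmb [DecidableEq Q] {c t : Q} (h : c ≠ t) (z : Fin 2 → Bool) (x : Q → Bool) :
    extend (pairEmb c t h) z x = update (update x c (z 0)) t (z 1) := by
  funext w
  by_cases ht : w = t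
  · subst ht
    rw [update_self]
    exact (pairEmb c w h).injective.extend_apply z x 1
  rw [update_of_ne ht]
  by_cases hc : w = c
  · subst hc
    rw [update_self]
    exact (pairEmb w t h).injective.extend_apply z x 0
  rw [update_of_ne hc, extend_apply']
  rintro ⟨i, rfl⟩
  fin_cases i
  · exact hc rfl
  · exact ht rfl

variable [Fintype Q] [DecidableEq Q] (I : P.Interpretation n)

/-- The gate does not touch the system, hence it does not mix different `j`. -/
lemma act_elementary_st {k : ℕ} (hk : k ≤ 2) (G : Matrix.unitaryGroup (Fin k → Bool) ℂ)
    (e : Fin k ↪ Q) :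
    (Gate.elementary k hk G e : Gate P Q).act I (st u χ) =
      st u fun j x => ∑ z, G.1 (x ∘ e) z * χ j (extend e z x) := by
  ext ⟨s, x⟩
  simp only [Gate.act, Gate.mat, st, place_mulVec, Fintype.sum_prod_type,
    Matrix.kroneckerMap_apply, Matrix.one_apply]
  rw [Finset.sum_eq_single s (fun s' _ h => by simp [Ne.symm h]) (by simp)]
  simp only [if_true, one_mul, Finset.mul_sum, Finset.sum_mul, mul_assoc]
  rw [Finset.sum_comm]

lemma run_hadC (w : Q) : (hadC w : Circuit P Q).run I (st u χ) =
    st u fun j x => (χ j (update x w false) + (if x w then -1 else 1) * χ j (update x w true)) /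
      (Real.sqrt 2 : ℂ) := by
  rw [hadC, Circuit.run_cons, act_elementary_st, Circuit.run_nil]
  congr 1
  funext j x
  rw [sum_fin_one_bool]
  change (if x w && false then -1 else 1) / (Real.sqrt 2 : ℂ) *
      χ j (extend (fun _ : Fin 1 => w) (fun _ => false) x) +
    (if x w && true then -1 else 1) / (Real.sqrt 2 : ℂ) *
      χ j (extend (fun _ : Fin 1 => w) (fun _ => true) x) = _
  rw [extend_const, extend_const, Bool.and_false, Bool.and_true]
  simp only [Bool.false_eq_true, if_false]
  ring

lemma run_cnotC {c t : Q} (h : c ≠ t) : (cnotC c t : Circuit P Q).run I (st u χ) =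
    st u fun j x => χ j (update x t (xor (x t) (x c))) := by
  rw [cnotC, dif_pos h, Circuit.run_cons, act_elementary_st, Circuit.run_nil]
  congr 1
  funext j x
  change ∑ z, (if z = cnotPerm (x ∘ pairEmb c t h) then (1 : ℂ) else 0) *
    χ j (extend (pairEmb c t h) z x) = _
  simp only [ite_mul, one_mul, zero_mul, Finset.sum_ite_eq', Finset.mem_univ,
    if_true, extend_pairEmb]
  congr 1
  have h0 : cnotPerm (x ∘ pairEmb c t h) 0 = x c := rfl
  have h1 : cnotPerm (x ∘ pairEmb c t h) 1 = xor (x t) (x c) := rfl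
  rw [h0, h1, update_eq_self]

lemma run_cphaseC {c t : Q} (h : c ≠ t) {ζ : ℂ} (hζ : ‖ζ‖ = 1) :
    (cphaseC ζ c t : Circuit P Q).run I (st u χ) =
      st u fun j x => (if x c && x t then ζ else 1) * χ j x := by
  rw [cphaseC, dif_pos ⟨h, hζ⟩, Circuit.run_cons, act_elementary_st, Circuit.run_nil]
  congr 1
  funext j x
  change ∑ z, Matrix.diagonal (fun a : Fin 2 → Bool => if a 0 && a 1 then ζ else 1)
    (x ∘ pairEmb c t h) z * χ j (extend (pairEmb c t h) z x) = _
  simp only [Matrix.diagonal_apply, ite_mul, zero_mul, Finset.sum_ite_eq,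
    Finset.mem_univ, if_true, extend_self_comp]
  rfl

variable {u} in
lemma norm_st_sq (hu : Orthonormal ℂ u) : ‖st u χ‖ ^ 2 = ∑ x, ∑ j, ‖χ j x‖ ^ 2 := by
  rw [EuclideanSpace.norm_sq_eq, Fintype.sum_prod_type, Finset.sum_comm]
  refine Finset.sum_congr rfl fun x _ => ?_
  have h : ‖∑ j, χ j x • u j‖ ^ 2 = ∑ j, ‖χ j x‖ ^ 2 := by
    apply Complex.ofReal_injective
    have := hu.inner_sum (fun j => χ j x) (fun j => χ j x) Finset.univ
    rw [inner_self_eq_norm_sq_to_K] at this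
    push_cast
    refine this.trans (Finset.sum_congr rfl fun j _ => ?_)
    rw [Complex.conj_mul']
  rw [← h, EuclideanSpace.norm_sq_eq]
  refine Finset.sum_congr rfl fun s _ => ?_
  simp [st]

end Elementary

/-! ### Singular value estimation on coefficient functions. -/

section Estimation

variable {P : Primitives} {n q a : ℕ}

/-- The assumption that the circuit `V` performs singular value estimation up to `η`, for left
singular vectors `u` and right singular vectors `star ζ j • u j` unless the `j`th singular value
vanishes, that is, `f j = false`; the qubit `t` of the value register holds the sign. -/
structure EstimatesSign (I : P.Interpretation n) (V : Circuit P (Wire q 0 a))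
    (u v : Fin n → EuclideanSpace ℂ (Fin n)) (ζ : Fin n → ℂ) (f : Fin n → Bool)
    (S : Fin n → Bool → EuclideanSpace ℂ (Fin q → Bool)) (t : Fin q) (η : ℝ) : Prop where
  orthonormal : Orthonormal ℂ u
  norm_phase : ∀ j, ‖ζ j‖ = 1
  right_eq : ∀ j, f j = true → v j = star (ζ j) • u j
  sign_iff : ∀ j s y, f j = true → S j s y ≠ 0 → (y t = true ↔ s = false)
  sign_eq : ∀ j s y, f j = false → S j s y ≠ 0 → y t = false
  eq_of_zero : ∀ j, f j = false → S j true = S j false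
  norm_sub_le : ∀ β : EuclideanSpace ℂ (Fin n × Bool),
      ‖V.run I (∑ j, ∑ s, (β (j, s) * (1 / Real.sqrt 2 : ℝ)) •
            registerState a (u j) ((sgn s : ℂ) • v j) (zeroKet q) (zeroKet 0)) -
          ∑ j, ∑ s, (β (j, s) * (1 / Real.sqrt 2 : ℝ)) •
            registerState a (u j) ((sgn s : ℂ) • v j) (S j s) (zeroKet 0)‖ ≤ η * ‖β‖

/-- The basis state with `b` in the block qubit and zeros in all other qubits. -/
def blockKet (q a : ℕ) (b : Bool) : Wire q 0 a → Bool := fun w => if w = .block then b else false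

/-- The ideal effect of singular value estimation on the coefficient functions. -/
def estimate {Q : Type} (ρ : Wire q 0 a ↪ Q) (ζ : Fin n → ℂ)
    (S : Fin n → Bool → EuclideanSpace ℂ (Fin q → Bool)) (χ : Fin n → (Q → Bool) → ℂ) :
    Fin n → (Q → Bool) → ℂ := fun j x =>
  (if ∀ i, x (ρ (.work i)) = false then 1 else 0) * ∑ s : Bool, 1 / 2 *
    (χ j (extend ρ (blockKet q a false) x) + sgn s * ζ j * χ j (extend ρ (blockKet q a true) x)) *
      (if x (ρ .block) then sgn s * star (ζ j) else 1) * S j s (fun i => x (ρ (.sing i)))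

/-- The value register and the work qubits of `ρ` are in the state zero. -/
def Clean {Q : Type} (ρ : Wire q 0 a ↪ Q) (χ : Fin n → (Q → Bool) → ℂ) : Prop :=
  ∀ j x, χ j x ≠ 0 → (∀ i, x (ρ (.sing i)) = false) ∧ ∀ i, x (ρ (.work i)) = false

lemma eq_blockKet {y : Wire q 0 a → Bool} (h₁ : ∀ i, y (.sing i) = false)
    (h₂ : ∀ i, y (.work i) = false) : y = blockKet q a (y .block) := by
  funext w
  cases w with
  | block => simp [blockKet]
  | sing i => simp [blockKet, h₁]
  | phase i => exact i.elim0
  | work i => simp [blockKet, h₂]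

lemma zeroKet_apply (k : ℕ) (x : Fin k → Bool) :
    zeroKet k x = if ∀ i, x i = false then 1 else 0 := by
  simp [zeroKet, funext_iff]

lemma zeroKet_zero (x : Fin 0 → Bool) : zeroKet 0 x = 1 := by
  simp [zeroKet_apply]

variable {I : P.Interpretation n} {V : Circuit P (Wire q 0 a)}
  {u v : Fin n → EuclideanSpace ℂ (Fin n)} {ζ : Fin n → ℂ} {f : Fin n → Bool}
  {S : Fin n → Bool → EuclideanSpace ℂ (Fin q → Bool)} {t : Fin q} {η : ℝ}

lemma sum_eq_of_clean {R : Type*} [AddCommMonoid R] (F : (Wire q 0 a → Bool) → R)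
    (hF : ∀ y, F y ≠ 0 → (∀ i, y (.sing i) = false) ∧ ∀ i, y (.work i) = false) :
    ∑ y, F y = F (blockKet q a false) + F (blockKet q a true) := by
  rw [add_comm, ← Fintype.sum_bool (fun b => F (blockKet q a b))]
  symm
  refine Finset.sum_of_injOn (blockKet q a) ?_ (by simp [Set.MapsTo]) ?_ (fun _ _ => rfl)
  · intro b _ b' _ h
    simpa [blockKet] using congrFun h .block
  · intro y _ hy
    by_contra h
    obtain ⟨h₁, h₂⟩ := hF y h
    exact hy ⟨y .block, by simp, (eq_blockKet h₁ h₂).symm⟩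

lemma ofReal_inv_sqrt_two_mul_self :
    ((1 / Real.sqrt 2 : ℝ) : ℂ) * ((1 / Real.sqrt 2 : ℝ) : ℂ) = 1 / 2 := by
  rw [← Complex.ofReal_mul]
  have : (1 / Real.sqrt 2 : ℝ) * (1 / Real.sqrt 2 : ℝ) = 1 / 2 := by
    rw [div_mul_div_comm, Real.mul_self_sqrt zero_le_two, one_mul]
  rw [this]; norm_num

/-- This is the assumption on `V` rewritten from the eigenvectors `w j ±` in terms of `|0⟩|u j⟩` and
`|1⟩|u j⟩`. On the kernel `|1⟩|u j⟩` need not lie in the plane of `w j ±`, so it has to be excluded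
by `hker`. -/
lemma EstimatesSign.norm_run_sub_le (h : EstimatesSign I V u v ζ f S t η)
    (χ : Fin n → (Wire q 0 a → Bool) → ℂ) (hχ : Clean (Embedding.refl _) χ)
    (hker : ∀ j x, f j = false → x .block = true → χ j x = 0) :
    ‖V.run I (st u χ) - st u (estimate (Embedding.refl _) ζ S χ)‖ ≤ η * ‖st u χ‖ := by
  have hχ0 : ∀ j y, (¬ ((∀ i, y (.sing i) = false) ∧ ∀ i, y (.work i) = false)) → χ j y = 0 :=
    fun j y hy => by_contra fun h => hy (hχ j y h)
  set A : Fin n → ℂ := fun j => χ j (blockKet q a false) with hA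
  set B : Fin n → ℂ := fun j => χ j (blockKet q a true) with hB
  have hBker : ∀ j, f j = false → B j = 0 := fun j hj => hker j _ hj (by simp [blockKet])
  -- From `|0⟩|u j⟩ = (w j + + w j -) / √2` and `|1⟩|u j⟩ = ζ j (w j + - w j -) / √2`; the
  -- parallelogram law shows that the norm is preserved.
  let β : EuclideanSpace ℂ (Fin n × Bool) :=
    WithLp.toLp 2 fun p => (A p.1 + sgn p.2 * ζ p.1 * B p.1) * (1 / Real.sqrt 2 : ℝ)
  have hβ : ∀ j s, β (j, s) * (1 / Real.sqrt 2 : ℝ) = 1 / 2 * (A j + sgn s * ζ j * B j) := by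
    intro j s
    change (A j + sgn s * ζ j * B j) * (1 / Real.sqrt 2 : ℝ) * (1 / Real.sqrt 2 : ℝ) = _
    rw [mul_assoc, ofReal_inv_sqrt_two_mul_self, mul_comm]
  have hnorm : ‖β‖ = ‖st u χ‖ := by
    rw [← pow_left_inj₀ (norm_nonneg _) (norm_nonneg _) two_ne_zero, norm_st_sq _ h.orthonormal,
      EuclideanSpace.norm_sq_eq, Finset.sum_comm, Fintype.sum_prod_type]
    refine Finset.sum_congr rfl fun j _ => ?_
    rw [sum_eq_of_clean (fun y => ‖χ j y‖ ^ 2)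
      (fun y hy => hχ j y (by simpa using hy)), Fintype.sum_bool]
    have hz : ‖ζ j * B j‖ = ‖B j‖ := by rw [norm_mul, h.norm_phase, one_mul]
    have hpar := parallelogram_law_with_norm ℝ (A j) (ζ j * B j)
    have hs : ‖((1 / Real.sqrt 2 : ℝ) : ℂ)‖ ^ 2 = 1 / 2 := by
      rw [Complex.norm_real, Real.norm_eq_abs, sq_abs, div_pow, Real.sq_sqrt zero_le_two]; norm_num
    have h1 : ‖β (j, true)‖ ^ 2 = ‖A j + ζ j * B j‖ ^ 2 * (1 / 2) := by
      change ‖(A j + (sgn true : ℂ) * ζ j * B j) * ((1 / Real.sqrt 2 : ℝ) : ℂ)‖ ^ 2 = _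
      rw [norm_mul, mul_pow, hs]
      simp [sgn]
    have h2 : ‖β (j, false)‖ ^ 2 = ‖A j - ζ j * B j‖ ^ 2 * (1 / 2) := by
      change ‖(A j + (sgn false : ℂ) * ζ j * B j) * ((1 / Real.sqrt 2 : ℝ) : ℂ)‖ ^ 2 = _
      rw [norm_mul, mul_pow, hs]
      simp [sgn, sub_eq_add_neg]
    rw [h1, h2]
    change _ = ‖A j‖ ^ 2 + ‖B j‖ ^ 2
    rw [← hz]
    linarith [hpar]
  have hin : (∑ j, ∑ s, (β (j, s) * (1 / Real.sqrt 2 : ℝ)) •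
      registerState a (u j) ((sgn s : ℂ) • v j) (zeroKet q) (zeroKet 0)) = st u χ := by
    ext ⟨r, y⟩
    simp only [hβ, WithLp.ofLp_sum, WithLp.ofLp_smul, WithLp.ofLp_add, Pi.add_apply,
      Finset.sum_apply, Pi.smul_apply, smul_eq_mul,
      registerState, st, zeroKet_zero, mul_one, Fintype.sum_bool]
    refine Finset.sum_congr rfl fun j _ => ?_
    by_cases hy : (∀ i, y (.sing i) = false) ∧ ∀ i, y (.work i) = false
    · rw [zeroKet_apply, zeroKet_apply, if_pos hy.1, if_pos hy.2, eq_blockKet hy.1 hy.2]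
      have hb : blockKet q a (y .block) .block = y .block := by simp [blockKet]
      rw [hb]
      cases hbl : y .block
      · change _ = A j * _
        simp [sgn]; ring
      · change _ = B j * _
        cases hf : f j
        · rw [hBker j hf]
          simp [sgn]
        · have hz : ζ j * star (ζ j) = 1 := by
            simp [Complex.mul_conj', h.norm_phase]
          rw [h.right_eq j hf]
          simp only [sgn, if_true, Bool.false_eq_true, if_false, Complex.ofReal_one,
            Complex.ofReal_neg, PiLp.smul_apply, smul_eq_mul]
          linear_combination (B j * u j r) * hz
    · rw [hχ0 j y hy, zeroKet_apply, zeroKet_apply]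
      rw [not_and_or] at hy
      rcases hy with hy | hy <;> simp [hy]
  have hout : (∑ j, ∑ s, (β (j, s) * (1 / Real.sqrt 2 : ℝ)) •
      registerState a (u j) ((sgn s : ℂ) • v j) (S j s) (zeroKet 0)) =
        st u (estimate (Embedding.refl _) ζ S χ) := by
    ext ⟨r, y⟩
    simp only [hβ, WithLp.ofLp_sum, WithLp.ofLp_smul, WithLp.ofLp_add, Pi.add_apply,
      Finset.sum_apply, Pi.smul_apply, smul_eq_mul,
      registerState, st, zeroKet_zero, mul_one, Fintype.sum_bool]
    refine Finset.sum_congr rfl fun j _ => ?_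
    have he : ∀ b, extend (Embedding.refl (Wire q 0 a)) (blockKet q a b) y = blockKet q a b := by
      intro b
      funext w
      exact (Embedding.refl _).injective.extend_apply _ _ w
    simp only [estimate, he, zeroKet_apply, Embedding.refl_apply, Fintype.sum_bool]
    change _ = _ * ((1 / 2 * (A j + sgn true * ζ j * B j) * _ * _) +
      (1 / 2 * (A j + sgn false * ζ j * B j) * _ * _)) * _
    cases hbl : y .block
    · simp only [Bool.false_eq_true, if_false]
      ring
    · cases hf : f j
      · rw [hBker j hf, h.eq_of_zero j hf]
        simp only [sgn, if_true, Bool.false_eq_true, if_false, mul_zero, add_zero, Complex.ofReal_one, Complex.ofReal_neg]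
        ring
      · rw [h.right_eq j hf]
        simp only [if_true, PiLp.smul_apply, smul_eq_mul]
        ring
  have := h.norm_sub_le β
  rwa [hin, hout, hnorm] at this

variable {Q : Type} [Fintype Q] [DecidableEq Q]

/-- The bound holds on every slice; summing the squares gives it on the whole machine. -/
lemma EstimatesSign.norm_run_rename_sub_le (h : EstimatesSign I V u v ζ f S t η) (hη : 0 ≤ η)
    (ρ : Wire q 0 a ↪ Q) (χ : Fin n → (Q → Bool) → ℂ) (hχ : Clean ρ χ)
    (hker : ∀ j x, f j = false → x (ρ .block) = true → χ j x = 0) :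
    ‖(V.rename ρ).run I (st u χ) - st u (estimate ρ ζ S χ)‖ ≤ η * ‖st u χ‖ := by
  have hslice : ∀ x, ‖slice ρ x ((V.rename ρ).run I (st u χ) - st u (estimate ρ ζ S χ))‖ ≤
      η * ‖slice ρ x (st u χ)‖ := by
    intro x
    have hx : slice ρ x ((V.rename ρ).run I (st u χ) - st u (estimate ρ ζ S χ)) =
        V.run I (slice ρ x (st u χ)) - slice ρ x (st u (estimate ρ ζ S χ)) := by
      rw [← slice_run]; rfl
    have hest : slice ρ x (st u (estimate ρ ζ S χ)) =
        st u (estimate (Embedding.refl _) ζ S fun j y => χ j (extend ρ y x)) := by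
      rw [slice_st]
      congr 1
      funext j y
      have he : ∀ b, extend (Embedding.refl (Wire q 0 a)) (blockKet q a b) y =
          blockKet q a b := by
        intro b
        funext w
        exact (Embedding.refl _).injective.extend_apply _ _ w
      simp only [estimate, extend_extend_self, he, ρ.injective.extend_apply, Embedding.refl_apply]
    rw [hx, hest, slice_st]
    apply h.norm_run_sub_le
    · intro j y hy
      have := hχ j _ hy
      simp only [ρ.injective.extend_apply] at this
      exact this
    · intro j y hj hy
      apply hker j _ hj
      rwa [ρ.injective.extend_apply]
  -- Slices are indexed by strings on all qubits, so each occurs with this multiplicity, on both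
  -- sides alike.
  have hcard : (0 : ℝ) < Fintype.card (Wire q 0 a → Bool) := by
    exact_mod_cast Fintype.card_pos
  have hsq : (Fintype.card (Wire q 0 a → Bool) : ℝ) *
      ‖(V.rename ρ).run I (st u χ) - st u (estimate ρ ζ S χ)‖ ^ 2 ≤
      (Fintype.card (Wire q 0 a → Bool) : ℝ) * (η * ‖st u χ‖) ^ 2 := by
    rw [mul_pow, mul_left_comm, ← sum_norm_slice_sq, ← sum_norm_slice_sq ρ, Finset.mul_sum]
    refine Finset.sum_le_sum fun x _ => ?_
    rw [← mul_pow]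
    exact pow_le_pow_left₀ (norm_nonneg _) (hslice x) 2
  exact le_of_sq_le_sq (le_of_mul_le_mul_left hsq hcard) (by positivity)

end Estimation

/-! ### The reflection obtained from the signs of the eigenvalues. -/

section Reflection

variable {P : Primitives} {n q a : ℕ} {Q : Type}

/-- The ideal effect of the reflection controlled by `p`: the block qubit `b` is flipped and the
state gets the phase `ζ j` or its inverse, unless the singular value vanishes. -/
def rotate [DecidableEq Q] (p b : Q) (ζ : Fin n → ℂ) (f : Fin n → Bool) (χ : Fin n → (Q → Bool) → ℂ) :
    Fin n → (Q → Bool) → ℂ := fun j x =>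
  if x p && f j then (if x b then star (ζ j) else ζ j) * χ j (update x b (!x b)) else χ j x

/-- The reflection about the nonnegative eigenspaces, controlled by the qubit `p`. -/
def reflC (V : Circuit P (Wire q 0 a)) (ρ : Wire q 0 a ↪ Q) (t : Fin q) (p : Q) : Circuit P Q :=
  V.rename ρ ++ cphaseC (-1) p (ρ (.sing t)) ++ Circuit.inv (V.rename ρ)

lemma time_reflC (V : Circuit P (Wire q 0 a)) (ρ : Wire q 0 a ↪ Q) (t : Fin q) (p : Q) :
    Circuit.time (reflC V ρ t p) ≤ 2 * V.time + 1 := by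
  simp only [reflC, Circuit.time_append, Circuit.time_inv, Circuit.time_rename]
  have := time_cphaseC (P := P) (-1) p (ρ (.sing t))
  omega

variable {I : P.Interpretation n} {V : Circuit P (Wire q 0 a)}
  {u v : Fin n → EuclideanSpace ℂ (Fin n)} {ζ : Fin n → ℂ} {f : Fin n → Bool}
  {S : Fin n → Bool → EuclideanSpace ℂ (Fin q → Bool)} {t : Fin q} {η : ℝ}

variable [DecidableEq Q]

lemma update_extend_blockKet (ρ : Wire q 0 a ↪ Q) (b b' : Bool) (x : Q → Bool) :
    update (extend ρ (blockKet q a b) x) (ρ .block) b' = extend ρ (blockKet q a b') x := by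
  funext w
  by_cases hw : ∃ i, ρ i = w
  · obtain ⟨i, rfl⟩ := hw
    by_cases hi : i = .block
    · subst hi
      simp [ρ.injective.extend_apply, blockKet]
    · rw [update_of_ne (fun h => hi (ρ.injective h))]
      simp [ρ.injective.extend_apply, blockKet, hi]
  · rw [update_of_ne (fun h => hw ⟨_, h.symm⟩), extend_apply' _ _ _ hw, extend_apply' _ _ _ hw]

/-- Off the kernel the sign digit multiplies the branch `s` by `sgn s`, and `s (A + s ζ B) = ζ B + s
ζ (star ζ A)`: the two block components are exchanged with phases. On the kernel the digit is zero
in both branches and nothing happens. -/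
lemma EstimatesSign.sign_mul_estimate (h : EstimatesSign I V u v ζ f S t η) (ρ : Wire q 0 a ↪ Q)
    {p : Q} (hp : ∀ w, ρ w ≠ p) (χ : Fin n → (Q → Bool) → ℂ) :
    (fun j x => (if x p && x (ρ (.sing t)) then -1 else 1) * estimate ρ ζ S χ j x) =
      estimate ρ ζ S (rotate p (ρ .block) ζ f χ) := by
  funext j x
  have hpx : ∀ b, extend ρ (blockKet q a b) x p = x p := fun b =>
    extend_apply' _ _ _ (by rintro ⟨w, hw⟩; exact hp w hw)
  have hbx : ∀ b, extend ρ (blockKet q a b) x (ρ .block) = b := fun b => by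
    simp [ρ.injective.extend_apply, blockKet]
  simp only [estimate, rotate, hpx, hbx, update_extend_blockKet]
  cases hxp : x p
  · simp
  cases hf : f j
  · have hs : ∀ s, (if x (ρ (.sing t)) then (-1 : ℂ) else 1) * S j s (fun i => x (ρ (.sing i))) =
        S j s (fun i => x (ρ (.sing i))) := by
      intro s
      by_cases h0 : S j s (fun i => x (ρ (.sing i))) = 0
      · simp [h0]
      · simp [h.sign_eq j s _ hf h0]
    simp only [Bool.true_and, Bool.and_false, Bool.false_eq_true, if_false, Finset.mul_sum]
    refine Finset.sum_congr rfl fun s _ => ?_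
    conv_rhs => rw [← hs]
    ring
  · have hs : ∀ s, (if x (ρ (.sing t)) then (-1 : ℂ) else 1) * S j s (fun i => x (ρ (.sing i))) =
        sgn s * S j s (fun i => x (ρ (.sing i))) := by
      intro s
      by_cases h0 : S j s (fun i => x (ρ (.sing i))) = 0
      · simp [h0]
      · have := h.sign_iff j s _ hf h0
        cases s <;> simp_all [sgn]
    have hz : ζ j * star (ζ j) = 1 := by
      simp [Complex.mul_conj', h.norm_phase]
    simp only [Bool.true_and, Bool.and_true, if_true, Finset.mul_sum]
    refine Finset.sum_congr rfl fun s _ => ?_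
    have hss : (sgn s : ℂ) * sgn s = 1 := by cases s <;> simp [sgn]
    simp only [Bool.not_true, Bool.not_false, Bool.false_eq_true, if_false]
    have hA : ζ j * χ j (extend ρ (blockKet q a true) x) +
        sgn s * ζ j * (star (ζ j) * χ j (extend ρ (blockKet q a false) x)) =
        sgn s * (χ j (extend ρ (blockKet q a false) x) +
          sgn s * ζ j * χ j (extend ρ (blockKet q a true) x)) := by
      linear_combination (sgn s * χ j (extend ρ (blockKet q a false) x)) * hz -
        (ζ j * χ j (extend ρ (blockKet q a true) x)) * hss
    rw [hA]
    linear_combination ((if ∀ i, x (ρ (.work i)) = false then (1 : ℂ) else 0) * (1 / 2 *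
      (χ j (extend ρ (blockKet q a false) x) +
          sgn s * ζ j * χ j (extend ρ (blockKet q a true) x)) *
      (if x (ρ .block) then sgn s * star (ζ j) else 1))) * hs s

lemma Clean.rotate {ρ : Wire q 0 a ↪ Q} {χ : Fin n → (Q → Bool) → ℂ} (hχ : Clean ρ χ) (p : Q) :
    Clean ρ (rotate p (ρ .block) ζ f χ) := by
  intro j x hx
  unfold QEig.rotate at hx
  split_ifs at hx
  all_goals first
    | exact hχ j x hx
    | have := hχ j _ (right_ne_zero_of_mul hx)
      simpa [update_of_ne, ρ.injective.eq_iff] using this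

variable [Fintype Q]

lemma norm_st_rotate (hu : Orthonormal ℂ u) (hζ : ∀ j, ‖ζ j‖ = 1) {p b : Q} (hpb : p ≠ b)
    (χ : Fin n → (Q → Bool) → ℂ) : ‖st u (rotate p b ζ f χ)‖ = ‖st u χ‖ := by
  rw [← pow_left_inj₀ (norm_nonneg _) (norm_nonneg _) two_ne_zero, norm_st_sq _ hu,
    norm_st_sq _ hu, Finset.sum_comm, Finset.sum_comm (s := Finset.univ (α := Q → Bool))]
  refine Finset.sum_congr rfl fun j _ => ?_
  cases hf : f j
  · simp [rotate, hf]
  have hinv : Function.Involutive fun x : Q → Bool => if x p then update x b (!x b) else x := by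
    intro x
    cases hx : x p
    · simp [hx]
    · simp [update_of_ne hpb, hx]
  rw [← Equiv.sum_comp hinv.toPerm]
  refine Finset.sum_congr rfl fun x _ => ?_
  rw [Function.Involutive.coe_toPerm, rotate]
  cases hx : x p
  · simp [hx]
  · simp only [hx, hf, if_true, Bool.and_self, update_of_ne hpb, update_self, update_idem,
      Bool.not_not, update_eq_self, norm_mul]
    cases x b <;> simp [hζ]

/-- One `η` comes from `V` on the input and one from `V` on the reflected state: applying `V` to
both sides turns the inverse run into a forward one. -/
lemma EstimatesSign.approx_reflC (h : EstimatesSign I V u v ζ f S t η) (hη : 0 ≤ η)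
    (ρ : Wire q 0 a ↪ Q) {p : Q} (hp : ∀ w, ρ w ≠ p) (χ : Fin n → (Q → Bool) → ℂ)
    (hχ : Clean ρ χ) (hker : ∀ j x, f j = false → x (ρ .block) = true → χ j x = 0) :
    Approx I (reflC V ρ t p) (2 * η) (st u χ) (st u (rotate p (ρ .block) ζ f χ)) := by
  have hn := norm_st_rotate (f := f) h.orthonormal h.norm_phase (hp .block).symm χ
  refine ⟨?_, hn⟩
  have h₁ := h.norm_run_rename_sub_le hη ρ χ hχ hker
  have h₂ := h.norm_run_rename_sub_le hη ρ _ (hχ.rotate (ζ := ζ) (f := f) p)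
    (fun j x hj hx => by simp [rotate, hj, hker j x hj hx])
  have hrun := run_cphaseC u (estimate ρ ζ S χ) I (hp (.sing t)).symm (ζ := -1) (by simp)
  rw [hn, ← h.sign_mul_estimate ρ hp, ← hrun] at h₂
  set D : Circuit P Q := cphaseC (-1) p (ρ (.sing t))
  set W := V.rename ρ
  rw [reflC, Circuit.run_append, Circuit.run_append]
  rw [← Circuit.run_inv_run I W (st u (rotate p (ρ .block) ζ f χ)), ← Circuit.run_sub,
    Circuit.norm_run]
  refine (norm_sub_le_norm_sub_add_norm_sub _ (D.run I (st u (estimate ρ ζ S χ))) _).trans ?_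
  rw [← Circuit.run_sub, Circuit.norm_run, norm_sub_rev (D.run I _), two_mul, add_mul]
  exact add_le_add h₁ h₂

end Reflection

/-! ### Controlled powers of the phases, with a flag protecting the kernel. -/

section ControlledPhase

variable {P : Primitives} {n q a : ℕ} {Q : Type}

/-- Stores in `g` whether the reflection controlled by `p` flips the block qubit. -/
def flagC (V : Circuit P (Wire q 0 a)) (ρ : Wire q 0 a ↪ Q) (t : Fin q) (g p : Q) : Circuit P Q :=
  reflC V ρ t p ++ cnotC (ρ .block) g ++ reflC V ρ t p

/-- `K` repetitions of the reflection controlled by `p`, each preceded by a flip of the block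
qubit controlled by `g`. -/
def powC (V : Circuit P (Wire q 0 a)) (ρ : Wire q 0 a ↪ Q) (t : Fin q) (g p : Q) :
    ℕ → Circuit P Q
  | 0 => []
  | K + 1 => powC V ρ t g p K ++ (cnotC g (ρ .block) ++ reflC V ρ t p)

/-- The phase `ζ j ^ K`, controlled by `p`. -/
def ctrlPhaseC (V : Circuit P (Wire q 0 a)) (ρ : Wire q 0 a ↪ Q) (t : Fin q) (g p : Q) (K : ℕ) :
    Circuit P Q :=
  flagC V ρ t g p ++ powC V ρ t g p K ++ Circuit.inv (flagC V ρ t g p)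

lemma time_flagC (V : Circuit P (Wire q 0 a)) (ρ : Wire q 0 a ↪ Q) (t : Fin q) (g p : Q) :
    Circuit.time (flagC V ρ t g p) ≤ 4 * V.time + 3 := by
  simp only [flagC, Circuit.time_append]
  have h₁ := time_reflC V ρ t p
  have h₂ := time_cnotC (P := P) (ρ .block) g
  omega

lemma time_powC (V : Circuit P (Wire q 0 a)) (ρ : Wire q 0 a ↪ Q) (t : Fin q) (g p : Q) (K : ℕ) :
    Circuit.time (powC V ρ t g p K) ≤ K * (2 * V.time + 2) := by
  induction K with
  | zero => simp [powC]
  | succ K ih =>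
    simp only [powC, Circuit.time_append, add_mul]
    have h₁ := time_reflC V ρ t p
    have h₂ := time_cnotC (P := P) g (ρ .block)
    omega

lemma time_ctrlPhaseC (V : Circuit P (Wire q 0 a)) (ρ : Wire q 0 a ↪ Q) (t : Fin q) (g p : Q)
    (K : ℕ) : Circuit.time (ctrlPhaseC V ρ t g p K) ≤ (K + 4) * (2 * V.time + 2) := by
  simp only [ctrlPhaseC, Circuit.time_append, Circuit.time_inv]
  have h₁ := time_flagC V ρ t g p
  have h₂ := time_powC V ρ t g p K
  rw [add_mul]
  omega

variable [DecidableEq Q] {I : P.Interpretation n} {V : Circuit P (Wire q 0 a)}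
  {u v : Fin n → EuclideanSpace ℂ (Fin n)} {ζ : Fin n → ℂ} {f : Fin n → Bool}
  {S : Fin n → Bool → EuclideanSpace ℂ (Fin q → Bool)} {t : Fin q} {η : ℝ}

/-- The coefficients after the flag `g` has been set and the phase `ζ j ^ K` has been produced. -/
def flagged (g p b : Q) (ζ : Fin n → ℂ) (f : Fin n → Bool) (K : ℕ) (χ : Fin n → (Q → Bool) → ℂ) :
    Fin n → (Q → Bool) → ℂ := fun j x =>
  if x b = false ∧ x g = (x p && f j) then
    (if x p && f j then ζ j ^ K else 1) * χ j (update x g false) else 0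

/-- The first reflection flips the block qubit exactly when `p` is set and `f j` holds, the NOT
copies this into `g`, and the second reflection restores the block qubit; its phase cancels the
first one. -/
lemma rotate_cnot_rotate (hζ : ∀ j, ‖ζ j‖ = 1) {g p b : Q} (hbg : b ≠ g) (hbp : b ≠ p)
    (hgp : g ≠ p) (χ : Fin n → (Q → Bool) → ℂ) (hχb : ∀ j x, x b = true → χ j x = 0)
    (hχg : ∀ j x, x g = true → χ j x = 0) :
    rotate p b ζ f (fun j x => rotate p b ζ f χ j (update x g (xor (x g) (x b)))) =
      flagged g p b ζ f 0 χ := by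
  funext j x
  have hz : ζ j * star (ζ j) = 1 := by simp [Complex.mul_conj', hζ]
  have hup : x b = false → update (update (update x b true) g false) b false =
      update x g false := by
    intro hx
    rw [update_comm hbg.symm, update_idem, ← hx, update_eq_self]
  cases hxb : x b <;> cases hxg : x g <;> cases hxp : x p <;> cases hf : f j <;>
    simp [flagged, rotate, hxb, hxg, hxp, hf, update_of_ne, hbg, hbg.symm, hbp.symm,
      hgp.symm, hχb, hχg]
  rw [hup hxb, ← mul_assoc]
  simp [Complex.mul_conj', hζ]

/-- If the flag is set, NOT and reflection lead from block `0` to block `1` and back, picking up one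
factor `ζ j`; otherwise neither of them acts. -/
lemma rotate_cnot_flagged {g p b : Q} (hbg : b ≠ g) (hbp : b ≠ p)
    (K : ℕ) (χ : Fin n → (Q → Bool) → ℂ) :
    rotate p b ζ f (fun j x => flagged g p b ζ f K χ j (update x b (xor (x b) (x g)))) =
      flagged g p b ζ f (K + 1) χ := by
  funext j x
  have hup : x b = false → update (update x b true) b false = x := by
    intro hx
    rw [update_idem, ← hx, update_eq_self]
  have hup' : x b = false → update x b false = x := by
    intro hx
    rw [← hx, update_eq_self]
  cases hxb : x b <;> cases hxg : x g <;> cases hxp : x p <;> cases hf : f j <;>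
    simp [flagged, rotate, hxb, hxg, hxp, hf, update_of_ne, hbg.symm, hbp.symm,
      hup', pow_succ']
  ring

lemma Clean.flagged {ρ : Wire q 0 a ↪ Q} {g p b : Q} (hg : ∀ w, ρ w ≠ g) (K : ℕ)
    {χ : Fin n → (Q → Bool) → ℂ} (hχ : Clean ρ χ) : Clean ρ (flagged g p b ζ f K χ) := by
  intro j x hx
  unfold QEig.flagged at hx
  split_ifs at hx
  all_goals first
    | exact absurd rfl hx
    | simpa [update_of_ne, hg] using hχ j _ (right_ne_zero_of_mul hx)

variable [Fintype Q]

lemma EstimatesSign.approx_flagC (h : EstimatesSign I V u v ζ f S t η) (hη : 0 ≤ η)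
    (ρ : Wire q 0 a ↪ Q) {g p : Q} (hg : ∀ w, ρ w ≠ g) (hp : ∀ w, ρ w ≠ p) (hgp : g ≠ p)
    (χ : Fin n → (Q → Bool) → ℂ) (hχ : Clean ρ χ)
    (hχb : ∀ j x, x (ρ .block) = true → χ j x = 0) (hχg : ∀ j x, x g = true → χ j x = 0) :
    Approx I (flagC V ρ t g p) (4 * η) (st u χ) (st u (flagged g p (ρ .block) ζ f 0 χ)) := by
  have h₁ := h.approx_reflC hη ρ hp χ hχ fun j x _ hx => hχb j x hx
  have h₂ := approx_of_run_eq (run_cnotC u (rotate p (ρ .block) ζ f χ) I (hg .block))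
  have h₃ := h.approx_reflC hη ρ hp
    (fun j x => rotate p (ρ .block) ζ f χ j (update x g (xor (x g) (x (ρ .block))))) ?_ ?_
  · refine ((h₁.append h₂).append h₃).of_eq (by ring) ?_
    rw [rotate_cnot_rotate h.norm_phase (hg _) (hp _) hgp χ hχb hχg]
  · intro j x hx
    have := hχ.rotate (ζ := ζ) (f := f) p j _ hx
    simpa [update_of_ne, hg] using this
  · intro j x hj hx
    simp only [rotate, hj, Bool.and_false, Bool.false_eq_true, if_false]
    exact hχb _ _ (by rw [update_of_ne (hg _), hx])

lemma EstimatesSign.approx_powC (h : EstimatesSign I V u v ζ f S t η) (hη : 0 ≤ η)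
    (ρ : Wire q 0 a ↪ Q) {g p : Q} (hg : ∀ w, ρ w ≠ g) (hp : ∀ w, ρ w ≠ p)
    (K : ℕ) (χ : Fin n → (Q → Bool) → ℂ) (hχ : Clean ρ χ) :
    Approx I (powC V ρ t g p K) (K * (2 * η)) (st u (flagged g p (ρ .block) ζ f 0 χ))
      (st u (flagged g p (ρ .block) ζ f K χ)) := by
  induction K with
  | zero => exact (approx_nil _).of_eq (by simp) rfl
  | succ K ih =>
    have h₂ := approx_of_run_eq
      (run_cnotC u (flagged g p (ρ .block) ζ f K χ) I (hg .block).symm)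
    have h₃ := h.approx_reflC hη ρ hp
      (fun j x => flagged g p (ρ .block) ζ f K χ j
        (update x (ρ .block) (xor (x (ρ .block)) (x g)))) ?_ ?_
    · refine (ih.append (h₂.append h₃)).of_eq (by push_cast; ring) ?_
      rw [rotate_cnot_flagged (hg _) (hp _)]
    · intro j x hx
      have := hχ.flagged hg K j _ hx
      simpa [update_of_ne, ρ.injective.eq_iff] using this
    -- On the kernel the flag is never set, so the block qubit stays `0`.
    · intro j x hj hx
      simp only [flagged, hj, Bool.and_false, update_self, update_of_ne (hg _).symm, hx]
      cases x g <;> simp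

/-- The phase `ζ j ^ K` commutes with setting the flag, so undoing the flag leaves only the phase.
The hypothesis `hf` makes the same formula valid on the kernel, where no phase is produced. -/
lemma EstimatesSign.approx_ctrlPhaseC (h : EstimatesSign I V u v ζ f S t η) (hη : 0 ≤ η)
    (hf : ∀ j, f j = false → ζ j = 1)
    (ρ : Wire q 0 a ↪ Q) {g p : Q} (hg : ∀ w, ρ w ≠ g) (hp : ∀ w, ρ w ≠ p) (hgp : g ≠ p)
    (K : ℕ) (χ : Fin n → (Q → Bool) → ℂ) (hχ : Clean ρ χ)
    (hχb : ∀ j x, x (ρ .block) = true → χ j x = 0) (hχg : ∀ j x, x g = true → χ j x = 0) :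
    Approx I (ctrlPhaseC V ρ t g p K) ((K + 4) * (2 * η)) (st u χ)
      (st u fun j x => (if x p then ζ j ^ K else 1) * χ j x) := by
  have h₁ := h.approx_flagC hη ρ hg hp hgp χ hχ hχb hχg
  have h₂ := h.approx_powC hη ρ hg hp K χ hχ
  have h₃ := h.approx_flagC hη ρ hg hp hgp (fun j x => (if x p then ζ j ^ K else 1) * χ j x)
    (fun j x hx => hχ j x (right_ne_zero_of_mul hx)) (fun j x hx => by simp [hχb j x hx])
    (fun j x hx => by simp [hχg j x hx])
  have heq : flagged g p (ρ .block) ζ f 0 (fun j x => (if x p then ζ j ^ K else 1) * χ j x) =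
      flagged g p (ρ .block) ζ f K χ := by
    funext j x
    cases hfj : f j
    · simp [flagged, hfj, hf j hfj]
    · simp [flagged, hfj, update_of_ne hgp.symm]
  rw [heq] at h₃
  exact ((h₁.append h₂).append h₃.inv).of_eq (by ring) rfl

end ControlledPhase

/-! ### Writing the estimate of the singular value. -/

section AppendEstimate

variable {P : Primitives} {n q a : ℕ} {Q : Type}

/-- Prepares the eigenvector of the Hermitian dilation with the positive eigenvalue. -/
def prepC (V : Circuit P (Wire q 0 a)) (ρ : Wire q 0 a ↪ Q) (t : Fin q) (h : Q) : Circuit P Q :=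
  hadC h ++ reflC V ρ t h ++ cnotC (ρ .block) h

/-- Appends an estimate of the singular value, using `ρ` for the reflection and `ρ'` for the
estimate itself. -/
def appendC (V : Circuit P (Wire q 0 a)) (ρ ρ' : Wire q 0 a ↪ Q) (t : Fin q) (h : Q) :
    Circuit P Q :=
  prepC V ρ t h ++ V.rename ρ' ++ Circuit.inv (prepC V ρ t h)

lemma time_prepC (V : Circuit P (Wire q 0 a)) (ρ : Wire q 0 a ↪ Q) (t : Fin q) (h : Q) :
    Circuit.time (prepC V ρ t h) ≤ 2 * V.time + 3 := by
  simp only [prepC, Circuit.time_append, time_hadC]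
  have h₁ := time_reflC V ρ t h
  have h₂ := time_cnotC (P := P) (ρ .block) h
  omega

lemma time_appendC (V : Circuit P (Wire q 0 a)) (ρ ρ' : Wire q 0 a ↪ Q) (t : Fin q) (h : Q) :
    Circuit.time (appendC V ρ ρ' t h) ≤ 5 * V.time + 6 := by
  simp only [appendC, Circuit.time_append, Circuit.time_inv, Circuit.time_rename]
  have := time_prepC V ρ t h
  omega

/-- The value register of `ρ`. -/
def singEmb (ρ : Wire q 0 a ↪ Q) : Fin q ↪ Q :=
  ⟨fun i => ρ (.sing i), fun _ _ h => Wire.sing.inj (ρ.injective h)⟩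

/-- The coefficients after the state `S j` has been put into the value register of `ρ`. -/
def appended (ρ : Wire q 0 a ↪ Q) (S : Fin n → EuclideanSpace ℂ (Fin q → Bool))
    (χ : Fin n → (Q → Bool) → ℂ) : Fin n → (Q → Bool) → ℂ := fun j x =>
  S j (x ∘ singEmb ρ) * χ j (extend (singEmb ρ) (fun _ => false) x)

lemma Clean.appended {ρ ρ' : Wire q 0 a ↪ Q} (hρ : ∀ w i, ρ w ≠ ρ' (.sing i))
    (S : Fin n → EuclideanSpace ℂ (Fin q → Bool)) {χ : Fin n → (Q → Bool) → ℂ} (hχ : Clean ρ χ) :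
    Clean ρ (appended ρ' S χ) := by
  intro j x hx
  have h := hχ j _ (right_ne_zero_of_mul hx)
  have he : ∀ w, extend (singEmb ρ') (fun _ => false) x (ρ w) = x (ρ w) := fun w =>
    extend_apply' _ _ _ (by rintro ⟨i, hi⟩; exact hρ w i hi.symm)
  simpa [he] using h

variable [DecidableEq Q] {I : P.Interpretation n} {V : Circuit P (Wire q 0 a)}
  {u v : Fin n → EuclideanSpace ℂ (Fin n)} {ζ : Fin n → ℂ} {f : Fin n → Bool}
  {S : Fin n → Bool → EuclideanSpace ℂ (Fin q → Bool)} {t : Fin q} {η : ℝ}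

/-- The coefficients after the preparation of the eigenvectors of the Hermitian dilation. -/
def prepared (h b : Q) (ζ : Fin n → ℂ) (f : Fin n → Bool) (χ : Fin n → (Q → Bool) → ℂ) :
    Fin n → (Q → Bool) → ℂ := fun j x =>
  if f j then (if x h then 0 else (if x b then star (ζ j) else 1) *
      (χ j (update x b false) / (Real.sqrt 2 : ℂ)))
    else χ j (update x h false) / (Real.sqrt 2 : ℂ)

/-- Off the kernel the block qubit and `h` become correlated by the reflection, and the NOT resets
`h`, leaving `(|0⟩|u j⟩ + star (ζ j) |1⟩|u j⟩) / √2`, which is `w j +`. On the kernel the block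
stays `0` and `h` stays in the state made by the Hadamard gate. -/
lemma cnot_rotate_hadamard {h b : Q} (hbh : b ≠ h) (χ : Fin n → (Q → Bool) → ℂ)
    (hχb : ∀ j x, x b = true → χ j x = 0) (hχh : ∀ j x, x h = true → χ j x = 0) :
    (fun j x => rotate h b ζ f (fun j x => (χ j (update x h false) +
      (if x h then -1 else 1) * χ j (update x h true)) / (Real.sqrt 2 : ℂ)) j
        (update x h (xor (x h) (x b)))) = prepared h b ζ f χ := by
  funext j x
  have hup : x b = true → x h = false → update (update (update x h true) b false) h false =
      update x b false := by
    intro _ hh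
    rw [update_comm hbh, update_idem, ← hh, update_eq_self]
  have hup' : x b = false → x h = false → update x h false = update x b false := by
    intro hb hh
    rw [← hb, update_eq_self, hb, ← hh, update_eq_self]
  cases hxb : x b <;> cases hxh : x h <;> cases hf : f j <;>
    simp [prepared, rotate, hxb, hxh, hf, update_of_ne, hbh, hbh.symm, hχb, hχh]
  · rw [hup' hxb hxh]
  · exact Or.inl (by rw [hup hxb hxh])

lemma Clean.prepared {ρ : Wire q 0 a ↪ Q} {h : Q} (hh : ∀ w, ρ w ≠ h)
    {χ : Fin n → (Q → Bool) → ℂ} (hχ : Clean ρ χ) :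
    Clean ρ (prepared h (ρ .block) ζ f χ) := by
  intro j x hx
  unfold QEig.prepared at hx
  split_ifs at hx
  all_goals first
    | exact absurd rfl hx
    | (have := hχ j _ (left_ne_zero_of_mul (right_ne_zero_of_mul hx))
       simpa [update_of_ne, ρ.injective.eq_iff] using this)
    | (have := hχ j _ (left_ne_zero_of_mul hx)
       simpa [update_of_ne, hh] using this)

lemma extend_update_comm {α : Type*} (e : α ↪ Q) (z : α → Bool) (x : Q → Bool) {w : Q}
    (hw : ∀ i, e i ≠ w) (c : Bool) : extend e z (update x w c) = update (extend e z x) w c := by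
  funext w'
  by_cases h : w' = w
  · subst h
    rw [extend_apply' _ _ _ (by rintro ⟨i, hi⟩; exact hw i hi), update_self, update_self]
  · rw [update_of_ne h]
    by_cases h' : ∃ i, e i = w'
    · obtain ⟨i, rfl⟩ := h'
      rw [e.injective.extend_apply, e.injective.extend_apply]
    · rw [extend_apply' _ _ _ h', extend_apply' _ _ _ h', update_of_ne h]

lemma extend_blockKet_false {ρ : Wire q 0 a ↪ Q} {x : Q → Bool}
    (hx : ∀ i, x (ρ (.work i)) = false) :
    extend ρ (blockKet q a false) x =
      update (extend (singEmb ρ) (fun _ => false) x) (ρ .block) false := by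
  have hs : ∀ w, (∀ i, ρ (.sing i) ≠ w) →
      extend (singEmb ρ) (fun _ => false) x w = x w := by
    intro w hw
    exact extend_apply' _ _ _ (by rintro ⟨i, hi⟩; exact hw i hi)
  funext w
  by_cases hw : ∃ i, ρ i = w
  · obtain ⟨i, rfl⟩ := hw
    rw [ρ.injective.extend_apply]
    cases i with
    | block => simp [blockKet]
    | sing i =>
      rw [update_of_ne (fun h => by cases ρ.injective h)]
      exact ((singEmb ρ).injective.extend_apply (fun _ => false) x i).symm
    | phase i => exact i.elim0
    | work i =>
      rw [update_of_ne (fun h => by cases ρ.injective h),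
        hs _ (fun k h => by cases ρ.injective h), hx]
      simp [blockKet]
  · rw [extend_apply' _ _ _ hw, update_of_ne (fun h => hw ⟨_, h.symm⟩),
      hs _ fun i h => hw ⟨_, h⟩]

/-- Off the kernel the prepared vector has no component along `w j -`, so only `S j true` is
written. On the kernel `|0⟩|u j⟩` contains both eigenvectors, but their estimates are the same state
by `eq_of_zero`. -/
lemma EstimatesSign.estimate_prepared (hV : EstimatesSign I V u v ζ f S t η)
    {ρ : Wire q 0 a ↪ Q} {h : Q} (hh : ∀ w, ρ w ≠ h) {χ : Fin n → (Q → Bool) → ℂ}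
    (hχ : Clean ρ χ) (hχb : ∀ j x, x (ρ .block) = true → χ j x = 0) :
    estimate ρ ζ S (prepared h (ρ .block) ζ f χ) =
      prepared h (ρ .block) ζ f (appended ρ (fun j => S j true) χ) := by
  funext j x
  have hhx : ∀ b, extend ρ (blockKet q a b) x h = x h := fun b =>
    extend_apply' _ _ _ (by rintro ⟨w, hw⟩; exact hh w hw)
  have hbx : ∀ b, extend ρ (blockKet q a b) x (ρ .block) = b := fun b => by
    simp [ρ.injective.extend_apply, blockKet]
  have hsb : ∀ i, singEmb ρ i ≠ ρ .block := fun i hi => by cases ρ.injective hi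
  have hsh : ∀ i, singEmb ρ i ≠ h := fun i => hh _
  have hcomp : ∀ w c, (∀ i, singEmb ρ i ≠ w) → update x w c ∘ singEmb ρ = x ∘ singEmb ρ := by
    intro w c hw
    funext i
    exact update_of_ne (hw i) _ _
  have hSx : (fun i => x (ρ (.sing i))) = x ∘ singEmb ρ := rfl
  have hz : ζ j * star (ζ j) = 1 := by
    simp [Complex.mul_conj', hV.norm_phase]
  simp only [estimate, prepared, hhx, hbx, update_extend_blockKet, appended,
    extend_update_comm _ _ _ hsb, extend_update_comm _ _ _ hsh, hcomp _ _ hsb, hcomp _ _ hsh, hSx,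
    Fintype.sum_bool]
  by_cases hw : ∀ i, x (ρ (.work i)) = false
  · rw [if_pos hw, extend_blockKet_false hw]
    cases hf : f j
    · have h0 : χ j (update (extend ρ (blockKet q a true) x) h false) = 0 :=
        hχb _ _ (by rw [update_of_ne (hh _), hbx])
      have heq := hV.eq_of_zero j hf
      cases hxb : x (ρ .block)
      · have hup : update (extend (singEmb ρ) (fun _ => false) x) (ρ .block) false =
            extend (singEmb ρ) (fun _ => false) x := by
          rw [update_eq_self_iff, extend_apply' _ _ _ (by rintro ⟨i, hi⟩; exact hsb i hi), hxb]
        simp only [h0, hup, heq, Bool.false_eq_true, if_false]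
        ring
      · have h1 : χ j (update (extend (singEmb ρ) (fun _ => false) x) h false) = 0 :=
          hχb _ _ (by rw [update_of_ne (hh _),
            extend_apply' _ _ _ (by rintro ⟨i, hi⟩; exact hsb i hi), hxb])
        simp only [h0, h1, heq, Bool.false_eq_true, if_false, if_true, sgn, Complex.ofReal_neg,
          Complex.ofReal_one]
        ring
    · cases hxh : x h
      · simp only [if_true, Bool.false_eq_true, if_false, sgn, Complex.ofReal_one,
          Complex.ofReal_neg]
        generalize χ j (update (extend (singEmb ρ) (fun _ => false) x) (ρ .block) false) = X
        generalize (S j true) (x ∘ singEmb ρ) = s₁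
        generalize (S j false) (x ∘ singEmb ρ) = s₂
        split_ifs
        · linear_combination (1 / 2 * X / (Real.sqrt 2 : ℂ) * star (ζ j) * (s₁ + s₂)) * hz
        · linear_combination (1 / 2 * X / (Real.sqrt 2 : ℂ) * (s₁ - s₂)) * hz
      · simp
  · have h0 : ∀ w c, (∀ i, singEmb ρ i ≠ w) → (∀ i, ρ (.work i) ≠ w) →
        χ j (update (extend (singEmb ρ) (fun _ => false) x) w c) = 0 := by
      intro w c _ hw₂
      by_contra hne
      apply hw
      intro i
      have := (hχ j _ hne).2 i
      rwa [update_of_ne (hw₂ i), extend_apply' _ _ _ (by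
        rintro ⟨k, hk⟩
        cases ρ.injective hk)] at this
    rw [if_neg hw, h0 _ _ hsb (fun i hi => by cases ρ.injective hi), h0 _ _ hsh (fun i => hh _)]
    simp

variable [Fintype Q]

lemma norm_st_appended (hu : Orthonormal ℂ u) (ρ : Wire q 0 a ↪ Q)
    {S : Fin n → EuclideanSpace ℂ (Fin q → Bool)} (hS : ∀ j, ‖S j‖ = 1)
    {χ : Fin n → (Q → Bool) → ℂ} (hχ : Clean ρ χ) : ‖st u (appended ρ S χ)‖ = ‖st u χ‖ := by
  rw [← pow_left_inj₀ (norm_nonneg _) (norm_nonneg _) two_ne_zero, norm_st_sq _ hu,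
    norm_st_sq _ hu, Finset.sum_comm, Finset.sum_comm (s := Finset.univ (α := Q → Bool))]
  refine Finset.sum_congr rfl fun j _ => ?_
  have hcard : (Fintype.card (Fin q → Bool) : ℝ) ≠ 0 := by
    exact_mod_cast Fintype.card_ne_zero
  apply mul_left_cancel₀ hcard
  rw [← sum_extend (singEmb ρ) (fun x => ‖appended ρ S χ j x‖ ^ 2),
    ← sum_extend (singEmb ρ) (fun x => ‖χ j x‖ ^ 2)]
  refine Finset.sum_congr rfl fun x _ => ?_
  rw [Finset.sum_eq_single (fun _ => false) (f := fun y => ‖χ j (extend (singEmb ρ) y x)‖ ^ 2)]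
  · simp only [appended, extend_comp_embedding, extend_extend_self, norm_mul, mul_pow]
    rw [← Finset.sum_mul, ← EuclideanSpace.norm_sq_eq, hS, one_pow, one_mul]
  · intro y _ hy
    by_contra hne
    apply hy
    funext i
    have := (hχ j (extend (singEmb ρ) y x) (by simpa using hne)).1 i
    rwa [show ρ (.sing i) = singEmb ρ i from rfl, (singEmb ρ).injective.extend_apply] at this
  · simp

lemma EstimatesSign.approx_prepC (hV : EstimatesSign I V u v ζ f S t η) (hη : 0 ≤ η)
    (ρ : Wire q 0 a ↪ Q) {h : Q} (hh : ∀ w, ρ w ≠ h)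
    (χ : Fin n → (Q → Bool) → ℂ) (hχ : Clean ρ χ)
    (hχb : ∀ j x, x (ρ .block) = true → χ j x = 0) (hχh : ∀ j x, x h = true → χ j x = 0) :
    Approx I (prepC V ρ t h) (2 * η) (st u χ) (st u (prepared h (ρ .block) ζ f χ)) := by
  have h₁ := approx_of_run_eq (run_hadC u χ I h)
  have h₂ := hV.approx_reflC hη ρ hh (fun j x => (χ j (update x h false) +
      (if x h then -1 else 1) * χ j (update x h true)) / (Real.sqrt 2 : ℂ)) ?_ ?_
  · have h₃ := approx_of_run_eq (run_cnotC u (rotate h (ρ .block) ζ f fun j x =>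
      (χ j (update x h false) +
      (if x h then -1 else 1) * χ j (update x h true)) / (Real.sqrt 2 : ℂ)) I (hh .block))
    refine ((h₁.append h₂).append h₃).of_eq (by ring) ?_
    rw [cnot_rotate_hadamard (hh _) χ hχb hχh]
  · intro j x hx
    have h0 : χ j (update x h true) = 0 := hχh _ _ (by simp)
    simp only [h0, mul_zero, add_zero] at hx
    simpa [update_of_ne, hh] using hχ j _ (left_ne_zero_of_mul hx)
  · intro j x _ hx
    rw [hχb _ (update x h false) (by rw [update_of_ne (hh _), hx]),
      hχb _ (update x h true) (by rw [update_of_ne (hh _), hx])]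
    simp

/-- The reflection in the undone preparation needs a clean value register while the estimate must be
kept; hence two embeddings, sharing the block qubit, with the value register of `ρ'` outside `ρ`.
The error is `2η` for each preparation and `η` for the estimate. -/
lemma EstimatesSign.approx_appendC (hV : EstimatesSign I V u v ζ f S t η) (hη : 0 ≤ η)
    (hS : ∀ j, ‖S j true‖ = 1) (ρ ρ' : Wire q 0 a ↪ Q) (hb : ρ' .block = ρ .block)
    (hρ : ∀ w i, ρ w ≠ ρ' (.sing i)) {h : Q} (hh : ∀ w, ρ w ≠ h) (hh' : ∀ w, ρ' w ≠ h)
    (χ : Fin n → (Q → Bool) → ℂ) (hχ : Clean ρ χ) (hχ' : Clean ρ' χ)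
    (hχb : ∀ j x, x (ρ .block) = true → χ j x = 0) (hχh : ∀ j x, x h = true → χ j x = 0) :
    Approx I (appendC V ρ ρ' t h) (5 * η) (st u χ)
      (st u (appended ρ' (fun j => S j true) χ)) := by
  have hzero : ∀ w, (∀ i, ρ' (.sing i) ≠ w) → (∀ j x, x w = true → χ j x = 0) →
      ∀ j x, x w = true → appended ρ' (fun j => S j true) χ j x = 0 := by
    intro w hw hχw j x hx
    rw [appended, hχw, mul_zero]
    rw [extend_apply' _ _ _ (by rintro ⟨i, hi⟩; exact hw i hi), hx]
  have h₁ := hV.approx_prepC hη ρ hh χ hχ hχb hχh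
  have h₃ := hV.approx_prepC hη ρ hh (appended ρ' (fun j => S j true) χ) (hχ.appended hρ _)
    (hzero _ (fun i => (hρ _ i).symm) hχb) (hzero _ (fun i => hh' _) hχh)
  have hn := norm_st_appended hV.orthonormal ρ' hS hχ'
  have h₂ : Approx I (V.rename ρ') η (st u (prepared h (ρ .block) ζ f χ))
      (st u (prepared h (ρ .block) ζ f (appended ρ' (fun j => S j true) χ))) := by
    refine ⟨?_, h₃.2.trans (hn.trans h₁.2.symm)⟩
    rw [← hb] at hχb ⊢
    rw [← hV.estimate_prepared hh' hχ' hχb]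
    refine hV.norm_run_rename_sub_le hη ρ' _ (hχ'.prepared hh') fun j x hj hx => ?_
    simp [prepared, hj, hχb j (update x h false) (by rw [update_of_ne (hh' _), hx])]
  exact ((h₁.append h₂).append h₃.inv).of_eq (by ring) rfl

end AppendEstimate

/-! ### Phase estimation, one binary digit after the other. -/

section PhaseEstimation

variable {P : Primitives} {n q a m : ℕ} {Q : Type}

/-- The phase by which the digit `l` turns the qubit `i` in the inverse Fourier transform. -/
def turn (l i : ℕ) : ℂ := Complex.exp (-(2 * Real.pi * Complex.I) * (2 ^ l / 2 ^ (i + 1)))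

lemma norm_turn (l i : ℕ) : ‖turn l i‖ = 1 := by
  have : turn l i = Complex.exp (((-(2 * Real.pi * (2 ^ l / 2 ^ (i + 1))) : ℝ) : ℂ) * Complex.I) := by
    rw [turn]
    congr 1
    push_cast
    ring
  rw [this, Complex.norm_exp_ofReal_mul_I]

/-- The factor of the digit `i` in the amplitude of phase estimation. -/
def digitAmp (ζ : ℂ) (i : Fin m) (y : Fin m → Bool) : ℂ :=
  (1 + ζ ^ 2 ^ (m - 1 - i) * (∏ l ∈ Finset.Iio i, if y l then turn l i else 1) *
    (if y i then -1 else 1)) / 2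

/-- The phase rotations of the qubit `i` that are controlled by the digits before `i`. -/
def turnsC (ph : Fin m ↪ Q) (i : Fin m) : Circuit P Q :=
  (Finset.Iio i).toList.flatMap fun l : Fin m => cphaseC (turn l i) (ph l) (ph i)

/-- The part of phase estimation that determines the digit `i`. -/
def digitC (V : Circuit P (Wire q 0 a)) (ρ : Wire q 0 a ↪ Q) (t : Fin q) (g : Q) (ph : Fin m ↪ Q)
    (i : Fin m) : Circuit P Q :=
  hadC (ph i) ++ ctrlPhaseC V ρ t g (ph i) (2 ^ (m - 1 - i)) ++ turnsC ph i ++ hadC (ph i)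

/-- Phase estimation for the first `k` digits. -/
def digitsC (V : Circuit P (Wire q 0 a)) (ρ : Wire q 0 a ↪ Q) (t : Fin q) (g : Q)
    (ph : Fin m ↪ Q) : ℕ → Circuit P Q
  | 0 => []
  | k + 1 => digitsC V ρ t g ph k ++ if h : k < m then digitC V ρ t g ph ⟨k, h⟩ else []

lemma time_flatMap_cphaseC (L : List (Fin m)) (ω : Fin m → ℂ) (c : Fin m → Q) (t : Q) :
    Circuit.time (L.flatMap fun l => cphaseC (ω l) (c l) t : Circuit P Q) ≤ L.length := by
  induction L with
  | nil => simp
  | cons l L ih =>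
    rw [List.flatMap_cons, Circuit.time_append, List.length_cons]
    have := time_cphaseC (P := P) (ω l) (c l) t
    omega

lemma time_digitC (V : Circuit P (Wire q 0 a)) (ρ : Wire q 0 a ↪ Q) (t : Fin q) (g : Q)
    (ph : Fin m ↪ Q) (i : Fin m) : Circuit.time (digitC V ρ t g ph i) ≤
      (2 ^ (m - 1 - i : ℕ) + 4) * (2 * V.time + 2) + i + 2 := by
  simp only [digitC, Circuit.time_append, time_hadC, turnsC]
  have h₁ := time_ctrlPhaseC V ρ t g (ph i) (2 ^ (m - 1 - i : ℕ))
  have h₂ := time_flatMap_cphaseC (P := P) (Finset.Iio i).toList (fun l => turn l i) ph (ph i)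
  rw [Finset.length_toList, Fin.card_Iio] at h₂
  omega

lemma time_digitsC (V : Circuit P (Wire q 0 a)) (ρ : Wire q 0 a ↪ Q) (t : Fin q) (g : Q)
    (ph : Fin m ↪ Q) (k : ℕ) : Circuit.time (digitsC V ρ t g ph k) ≤
      ∑ i ∈ Finset.range k, ((2 ^ (m - 1 - i) + 4) * (2 * V.time + 2) + i + 2) := by
  induction k with
  | zero => simp [digitsC]
  | succ k ih =>
    rw [digitsC, Circuit.time_append, Finset.sum_range_succ]
    refine add_le_add ih ?_
    split_ifs with h
    · exact time_digitC V ρ t g ph ⟨k, h⟩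
    · simp

lemma sum_range_two_pow_sub (m : ℕ) : ∑ i ∈ Finset.range m, 2 ^ (m - 1 - i) ≤ 2 ^ m := by
  rw [Finset.sum_range_reflect (fun i => 2 ^ i) m]
  exact (Nat.geomSum_lt le_rfl fun i hi => Finset.mem_range.1 hi).le

/-- The powers `2 ^ (m - 1 - i)` form a geometric sum, and both the overhead per digit and the
quadratically many rotations are absorbed in `2 ^ m`. -/
lemma time_digitsC_le (V : Circuit P (Wire q 0 a)) (ρ : Wire q 0 a ↪ Q) (t : Fin q) (g : Q)
    (ph : Fin m ↪ Q) : Circuit.time (digitsC V ρ t g ph m) ≤ 2 ^ m * (10 * V.time + 13) := by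
  refine (time_digitsC V ρ t g ph m).trans ?_
  simp only [Finset.sum_add_distrib, ← Finset.sum_mul, Finset.sum_const, Finset.card_range,
    smul_eq_mul]
  have h₁ := sum_range_two_pow_sub m
  have h₂ : ∑ i ∈ Finset.range m, i ≤ 2 ^ m :=
    (Finset.sum_le_sum fun i _ => Nat.lt_two_pow_self.le).trans
      (Nat.geomSum_lt le_rfl fun i hi => Finset.mem_range.1 hi).le
  have h₃ : m ≤ 2 ^ m := Nat.lt_two_pow_self.le
  have h₄ := Nat.mul_le_mul_right (2 * V.time + 2)
    (show ∑ i ∈ Finset.range m, 2 ^ (m - 1 - i) + m * 4 ≤ 5 * 2 ^ m by omega)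
  linarith

variable {I : P.Interpretation n} {V : Circuit P (Wire q 0 a)}
  {u v : Fin n → EuclideanSpace ℂ (Fin n)} {ζ : Fin n → ℂ} {f : Fin n → Bool}
  {S : Fin n → Bool → EuclideanSpace ℂ (Fin q → Bool)} {t : Fin q} {η : ℝ}

/-- The coefficients after phase estimation for the first `k` digits. -/
def digitsState (ph : Fin m ↪ Q) (ζ : Fin n → ℂ) (k : ℕ) (χ : Fin n → (Q → Bool) → ℂ) :
    Fin n → (Q → Bool) → ℂ := fun j x =>
  if ∀ l : Fin m, k ≤ l → x (ph l) = false then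
    (∏ l : Fin m with l.val < k, digitAmp (ζ j) l (x ∘ ph)) *
      χ j (extend ph (fun _ => false) x) else 0

lemma digitsState_ne_zero {ph : Fin m ↪ Q} {k : ℕ} {χ : Fin n → (Q → Bool) → ℂ} {j : Fin n}
    {x : Q → Bool} (h : digitsState ph ζ k χ j x ≠ 0) :
    χ j (extend ph (fun _ => false) x) ≠ 0 := by
  unfold digitsState at h
  split_ifs at h
  · exact right_ne_zero_of_mul h
  · exact absurd rfl h

lemma digitAmp_congr (ζ : ℂ) {i : Fin m} {y y' : Fin m → Bool} (h : ∀ l ≤ i, y l = y' l) :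
    digitAmp ζ i y = digitAmp ζ i y' := by
  unfold digitAmp
  rw [h i le_rfl, Finset.prod_congr rfl fun l hl => by rw [h l (Finset.mem_Iio.1 hl).le]]

variable [DecidableEq Q]

/-- The recursion behind phase estimation: the amplitude of the digit `i` depends only on the digits
up to `i`, so the earlier factors do not see the new digit. -/
lemma digitsState_update (ph : Fin m ↪ Q) (χ : Fin n → (Q → Bool) → ℂ) (i : Fin m) (j : Fin n)
    (x : Q → Bool) : digitAmp (ζ j) i (x ∘ ph) *
      digitsState ph ζ i χ j (update x (ph i) false) = digitsState ph ζ (i + 1) χ j x := by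
  have he : extend ph (fun _ => false) (update x (ph i) false) =
      extend ph (fun _ => false) x := by
    funext w
    by_cases hw : ∃ l, ph l = w
    · obtain ⟨l, rfl⟩ := hw
      rw [ph.injective.extend_apply, ph.injective.extend_apply]
    · rw [extend_apply' _ _ _ hw, extend_apply' _ _ _ hw,
        update_of_ne (fun h => hw ⟨i, h.symm⟩)]
  have hc : (∀ l : Fin m, i.val ≤ l → update x (ph i) false (ph l) = false) ↔
      ∀ l : Fin m, i.val + 1 ≤ l → x (ph l) = false := by
    refine forall_congr' fun l => ?_
    by_cases hl : l = i
    · subst hl; simp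
    · rw [update_of_ne (fun h => hl (ph.injective h))]
      have : l.val ≠ i.val := fun h => hl (Fin.ext h)
      constructor
      · intro h h'; exact h (by omega)
      · intro h h'; exact h (by omega)
  have hset : (Finset.univ.filter fun l : Fin m => l.val < i.val + 1) =
      insert i (Finset.univ.filter fun l : Fin m => l.val < i.val) := by
    ext l
    simp [Fin.ext_iff]
    omega
  simp only [digitsState, he, hc]
  split_ifs
  · rw [hset, Finset.prod_insert (by simp), ← mul_assoc]
    congr 2
    refine Finset.prod_congr rfl fun l hl => digitAmp_congr _ fun k hk => ?_
    have hl' : l.val < i.val := by simpa using hl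
    refine update_of_ne (fun h => ?_) _ _
    have := ph.injective h
    subst this
    exact absurd hk (by simpa using hl')
  · simp

variable [Fintype Q]

lemma run_flatMap_cphaseC (L : List (Fin m)) {ω : Fin m → ℂ} (hω : ∀ l, ‖ω l‖ = 1)
    (c : Fin m → Q) (t : Q) (hc : ∀ l ∈ L, c l ≠ t) (χ : Fin n → (Q → Bool) → ℂ) :
    Circuit.run I (L.flatMap fun l => cphaseC (ω l) (c l) t : Circuit P Q) (st u χ) =
      st u fun j x => (L.map fun l => if x (c l) && x t then ω l else 1).prod * χ j x := by
  induction L generalizing χ with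
  | nil => simp
  | cons l L ih =>
    rw [List.flatMap_cons, Circuit.run_append, run_cphaseC u χ I (hc l (by simp)) (hω l),
      ih (fun l hl => hc l (by simp [hl]))]
    congr 1
    funext j x
    simp only [List.map_cons, List.prod_cons]
    ring

/-- The qubit `i` starts in zero. Between the two Hadamard gates its component `1` receives `ζ j ^ 2
^ (m - 1 - i)` and the rotations by the digits already found, so the value `b` gets the amplitude
`(1 + (-1) ^ b * phase) / 2`, which is `digitAmp`. The inverse Fourier transform is thus interleaved
with the powers and no reversal of the qubits is needed. -/
lemma EstimatesSign.approx_digitC (hV : EstimatesSign I V u v ζ f S t η) (hη : 0 ≤ η)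
    (hf : ∀ j, f j = false → ζ j = 1) (ρ : Wire q 0 a ↪ Q) {g : Q} (ph : Fin m ↪ Q)
    (hg : ∀ w, ρ w ≠ g) (hp : ∀ w i, ρ w ≠ ph i) (hgp : ∀ i, g ≠ ph i)
    (χ : Fin n → (Q → Bool) → ℂ) (hχ : Clean ρ χ)
    (hχb : ∀ j x, x (ρ .block) = true → χ j x = 0) (hχg : ∀ j x, x g = true → χ j x = 0)
    (i : Fin m) :
    Approx I (digitC V ρ t g ph i) ((2 ^ (m - 1 - i : ℕ) + 4) * (2 * η))
      (st u (digitsState ph ζ i χ)) (st u (digitsState ph ζ (i + 1) χ)) := by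
  set X := digitsState ph ζ i χ with hX
  have hext : ∀ x w, (∀ i, ph i ≠ w) → extend ph (fun _ => false) x w = x w := by
    intro x w hw
    exact extend_apply' _ _ _ (by rintro ⟨l, hl⟩; exact hw l hl)
  have hX1 : ∀ j x, X j (update x (ph i) true) = 0 := by
    intro j x
    rw [hX, digitsState, if_neg]
    intro h
    simpa using h i le_rfl
  have hzero : ∀ w, (∀ i, ph i ≠ w) → (∀ j x, x w = true → χ j x = 0) →
      ∀ j x, x w = true → X j (update x (ph i) false) = 0 := by
    intro w hw hχw j x hx
    by_contra h
    refine digitsState_ne_zero h (hχw _ _ ?_)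
    rw [hext _ _ hw, update_of_ne (hw i).symm, hx]
  have h₁ := approx_of_run_eq (run_hadC u X I (ph i))
  have h₂ := hV.approx_ctrlPhaseC hη hf ρ hg (fun w => hp w i) (hgp i) (2 ^ (m - 1 - i : ℕ))
    (fun j x => (X j (update x (ph i) false) +
      (if x (ph i) then -1 else 1) * X j (update x (ph i) true)) / (Real.sqrt 2 : ℂ)) ?_ ?_ ?_
  · have h₃ := approx_of_run_eq (run_flatMap_cphaseC (P := P) (I := I) (u := u)
      (Finset.Iio i).toList (fun l => norm_turn l i) ph (ph i) (fun l hl h => by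
        have := ph.injective h
        subst this
        simp at hl) (fun j x => (if x (ph i) then ζ j ^ 2 ^ (m - 1 - i : ℕ) else 1) *
          ((X j (update x (ph i) false) +
      (if x (ph i) then -1 else 1) * X j (update x (ph i) true)) / (Real.sqrt 2 : ℂ))))
    have h₄ := approx_of_run_eq (run_hadC u (fun j x => ((Finset.Iio i).toList.map fun l =>
      if x (ph l) && x (ph i) then turn l i else 1).prod *
      ((if x (ph i) then ζ j ^ 2 ^ (m - 1 - i : ℕ) else 1) *
          ((X j (update x (ph i) false) +
      (if x (ph i) then -1 else 1) * X j (update x (ph i) true)) / (Real.sqrt 2 : ℂ)))) I (ph i))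
    refine (((h₁.append h₂).append h₃).append h₄).of_eq (by push_cast; ring) ?_
    congr 1
    funext j x
    rw [← digitsState_update, ← hX]
    simp only [hX1, Finset.prod_map_toList, update_self, update_idem, Bool.and_false,
      Bool.and_true, Bool.false_eq_true, if_false, if_true, Finset.prod_const_one, mul_zero,
      add_zero, one_mul]
    have hprod : (∏ l ∈ Finset.Iio i, if update x (ph i) true (ph l) then turn l i else 1) =
        ∏ l ∈ Finset.Iio i, if (x ∘ ph) l then turn l i else 1 := by
      refine Finset.prod_congr rfl fun l hl => ?_
      rw [update_of_ne fun h => (Finset.mem_Iio.1 hl).ne (ph.injective h)]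
      rfl
    rw [hprod, digitAmp]
    have h2 := sqrt_two_mul_self
    have h2' : (Real.sqrt 2 : ℂ) ≠ 0 := by simp
    simp only [Function.comp_apply]
    field_simp
    rw [pow_two, h2]
    ring
  · intro j x hx
    simp only [hX1, mul_zero, add_zero] at hx
    have := hχ j _ (digitsState_ne_zero (left_ne_zero_of_mul hx))
    simpa [hext _ _ fun i => (hp _ i).symm, update_of_ne, hp] using this
  · intro j x hx
    simp [hX1, hzero _ (fun i => (hp _ i).symm) hχb j x hx]
  · intro j x hx
    simp [hX1, hzero _ (fun i => (hgp i).symm) hχg j x hx]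

lemma EstimatesSign.approx_digitsC (hV : EstimatesSign I V u v ζ f S t η) (hη : 0 ≤ η)
    (hf : ∀ j, f j = false → ζ j = 1) (ρ : Wire q 0 a ↪ Q) {g : Q} (ph : Fin m ↪ Q)
    (hg : ∀ w, ρ w ≠ g) (hp : ∀ w i, ρ w ≠ ph i) (hgp : ∀ i, g ≠ ph i)
    (χ : Fin n → (Q → Bool) → ℂ) (hχ : Clean ρ χ)
    (hχb : ∀ j x, x (ρ .block) = true → χ j x = 0) (hχg : ∀ j x, x g = true → χ j x = 0)
    (k : ℕ) (hk : k ≤ m) :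
    Approx I (digitsC V ρ t g ph k)
      (∑ i ∈ Finset.range k, (2 ^ (m - 1 - i) + 4) * (2 * η))
      (st u (digitsState ph ζ 0 χ)) (st u (digitsState ph ζ k χ)) := by
  induction k with
  | zero => exact (approx_nil _).of_eq (by simp) rfl
  | succ k ih =>
    rw [digitsC, Finset.sum_range_succ, dif_pos (Nat.lt_of_succ_le hk)]
    exact (ih (by omega)).append
      (hV.approx_digitC hη hf ρ ph hg hp hgp χ hχ hχb hχg ⟨k, hk⟩)

lemma EstimatesSign.approx_phaseEstimation (hV : EstimatesSign I V u v ζ f S t η) (hη : 0 ≤ η)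
    (hf : ∀ j, f j = false → ζ j = 1) (ρ : Wire q 0 a ↪ Q) {g : Q} (ph : Fin m ↪ Q)
    (hg : ∀ w, ρ w ≠ g) (hp : ∀ w i, ρ w ≠ ph i) (hgp : ∀ i, g ≠ ph i)
    (χ : Fin n → (Q → Bool) → ℂ) (hχ : Clean ρ χ)
    (hχb : ∀ j x, x (ρ .block) = true → χ j x = 0) (hχg : ∀ j x, x g = true → χ j x = 0)
    (hχp : ∀ j x i, x (ph i) = true → χ j x = 0) :
    Approx I (digitsC V ρ t g ph m) (2 ^ m * (10 * η)) (st u χ)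
      (st u fun j x => (∏ l, digitAmp (ζ j) l (x ∘ ph)) *
        χ j (extend ph (fun _ => false) x)) := by
  have h := hV.approx_digitsC hη hf ρ ph hg hp hgp χ hχ hχb hχg m le_rfl
  have h0 : digitsState ph ζ 0 χ = χ := by
    funext j x
    rw [digitsState]
    split_ifs with hx
    · have : extend ph (fun _ => false) x = x := by
        conv_rhs => rw [← extend_self_comp ph x]
        congr 1
        funext i
        exact (hx i (Nat.zero_le _)).symm
      simp [this]
    · push Not at hx
      obtain ⟨l, _, hl⟩ := hx
      exact (hχp j x l (by simpa using hl)).symm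
  have h1 : digitsState ph ζ m χ = fun j x => (∏ l, digitAmp (ζ j) l (x ∘ ph)) *
        χ j (extend ph (fun _ => false) x) := by
    funext j x
    rw [digitsState, if_pos fun l hl => absurd l.2 (by omega)]
    congr 2
    ext l
    simp
  rw [h0, h1] at h
  refine h.mono ?_
  rw [← Finset.sum_mul, Finset.sum_add_distrib, Finset.sum_const, Finset.card_range]
  have h₁ : (∑ i ∈ Finset.range m, (2 : ℝ) ^ (m - 1 - i)) ≤ 2 ^ m := by
    exact_mod_cast sum_range_two_pow_sub m
  have h₂ : (m : ℝ) ≤ 2 ^ m := by exact_mod_cast Nat.lt_two_pow_self.le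
  have h₃ : (∑ i ∈ Finset.range m, (2 : ℝ) ^ (m - 1 - i)) + m • (4 : ℝ) ≤ 2 ^ m * 5 := by
    rw [nsmul_eq_mul]
    linarith
  calc _ ≤ (2 ^ m * 5) * (2 * η) := by gcongr
    _ = _ := by ring

end PhaseEstimation

/-! ### Amplitudes of phase estimation and the weight of bad outcomes. -/

section Tail

lemma sum_update_add_sum_update {Q : Type} [Fintype Q] [DecidableEq Q] (F : (Q → Bool) → ℝ)
    (w : Q) : ∑ x, (F (update x w false) + F (update x w true)) = 2 * ∑ x, F x := by
  have h := sum_extend (⟨fun _ => w, fun _ _ _ => Subsingleton.elim _ _⟩ : Fin 1 ↪ Q) F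
  simp only [sum_fin_one_bool] at h
  have h2 : (Fintype.card (Fin 1 → Bool) : ℝ) = 2 := by simp
  rw [← h2, ← h]
  refine Finset.sum_congr rfl fun x _ => ?_
  rw [← extend_const, ← extend_const]
  rfl

lemma intValue_succ {k : ℕ} (x : Fin (k + 1) → Bool) :
    intValue x = (if x 0 then 1 else 0) + 2 * intValue (fun i => x i.succ) := by
  simp only [intValue, Fin.sum_univ_succ, Finset.mul_sum]
  congr 1
  refine Finset.sum_congr rfl fun i _ => ?_
  split_ifs
  · rw [Fin.val_succ, pow_succ']
  · simp

lemma intValue_lt {k : ℕ} (x : Fin k → Bool) : intValue x < 2 ^ k := by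
  induction k with
  | zero => simp [intValue]
  | succ k ih =>
    rw [intValue_succ, pow_succ]
    have := ih fun i => x i.succ
    split_ifs <;> omega

lemma intValue_injective {k : ℕ} : Function.Injective (intValue (k := k)) := by
  induction k with
  | zero => exact fun _ _ _ => Subsingleton.elim _ _
  | succ k ih =>
    intro x y h
    rw [intValue_succ, intValue_succ] at h
    have h0 : x 0 = y 0 := by
      cases hx : x 0 <;> cases hy : y 0 <;> simp [hx, hy] at h ⊢ <;> omega
    have h1 : (fun i : Fin k => x i.succ) = fun i => y i.succ := by
      apply ih
      rw [h0] at h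
      omega
    funext i
    refine Fin.cases h0 (fun i => congrFun h1 i) i

lemma top_digit_iff {k : ℕ} (x : Fin (k + 1) → Bool) :
    x (Fin.last k) = true ↔ 2 ^ (k + 1) ≤ 2 * intValue x := by
  have h : intValue x = intValue (fun i : Fin k => x i.castSucc) +
      if x (Fin.last k) then 2 ^ k else 0 := by
    simp [intValue, Fin.sum_univ_castSucc]
  have hlt := intValue_lt fun i : Fin k => x i.castSucc
  rw [h, pow_succ]
  cases x (Fin.last k) <;> simp <;> omega

variable {m : ℕ}

lemma turn_self (i : ℕ) : turn i i = -1 := by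
  rw [turn, show -(2 * Real.pi * Complex.I) * ((2 : ℂ) ^ i / 2 ^ (i + 1)) =
    -(Real.pi * Complex.I) by field_simp; ring, Complex.exp_neg, Complex.exp_pi_mul_I]
  norm_num

lemma turn_of_lt {l i : ℕ} (h : i < l) : turn l i = 1 := by
  obtain ⟨k, rfl⟩ := Nat.exists_eq_add_of_lt h
  rw [turn, show -(2 * Real.pi * Complex.I) * ((2 : ℂ) ^ (i + k + 1) / 2 ^ (i + 1)) =
    -((2 ^ k : ℕ) * (2 * Real.pi * Complex.I)) by push_cast; field_simp; ring, Complex.exp_neg,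
    Complex.exp_nat_mul_two_pi_mul_I, inv_one]

/-- The digit `i` itself contributes `turn i i = -1`, and the higher digits contribute whole turns,
so the product extends over all digits of `y`. -/
lemma prod_turn (i : Fin m) (y : Fin m → Bool) :
    (∏ l ∈ Finset.Iio i, if y l then turn l i else 1) * (if y i then -1 else 1) =
      Complex.exp (-(2 * Real.pi * Complex.I) * (intValue y / 2 ^ (i + 1 : ℕ))) := by
  have h₁ : (∏ l ∈ Finset.Iio i, if y l then turn l i else 1) * (if y i then -1 else 1) =
      ∏ l ∈ Finset.Iic i, if y l then turn l i else 1 := by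
    rw [← Finset.Iio_insert, Finset.prod_insert (by simp), turn_self, mul_comm]
  have h₂ : (∏ l ∈ Finset.Iic i, if y l then turn l i else 1) =
      ∏ l : Fin m, if y l then turn l i else 1 := by
    refine Finset.prod_subset (Finset.subset_univ _) fun l _ hl => ?_
    rw [turn_of_lt (by simpa using hl), ite_self]
  rw [h₁, h₂, intValue]
  push_cast
  rw [Finset.sum_div, Finset.mul_sum, Complex.exp_sum]
  refine Finset.prod_congr rfl fun l _ => ?_
  split_ifs
  · rfl
  · simp

lemma digitAmp_exp (θ : ℝ) (i : Fin m) (y : Fin m → Bool) :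
    digitAmp (Complex.exp (2 * Real.pi * Complex.I * θ)) i y =
      (1 + Complex.exp (2 * Real.pi * Complex.I * (θ - phaseValue y : ℝ)) ^ 2 ^ (m - 1 - i : ℕ)) /
        2 := by
  rw [digitAmp, mul_assoc, prod_turn, ← Complex.exp_nat_mul, ← Complex.exp_nat_mul,
    ← Complex.exp_add]
  congr 3
  have hm : (2 : ℂ) ^ m = 2 ^ (m - 1 - i : ℕ) * 2 ^ (i + 1 : ℕ) := by
    rw [← pow_add]
    congr 1
    have := i.2
    omega
  rw [phaseValue]
  push_cast
  rw [hm]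
  field_simp
  ring

lemma sub_one_mul_prod_one_add (z : ℂ) (m : ℕ) :
    (z - 1) * ∏ k ∈ Finset.range m, (1 + z ^ 2 ^ k) = z ^ 2 ^ m - 1 := by
  induction m with
  | zero => simp
  | succ m ih =>
    rw [Finset.prod_range_succ, ← mul_assoc, ih, pow_succ, pow_mul]
    ring

/-- The amplitudes of phase estimation. -/
def phaseAmp (m : ℕ) (ζ : ℂ) : EuclideanSpace ℂ (Fin m → Bool) :=
  WithLp.toLp 2 fun y => ∏ l, digitAmp ζ l y

/-- With `z = exp (2πi (θ - phaseValue y))` the amplitude is `∏ k < m, (1 + z ^ 2 ^ k) / 2`;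
multiplied by `z - 1` it telescopes to `(z ^ 2 ^ m - 1) / 2 ^ m`. -/
lemma norm_phaseAmp_mul_le (θ : ℝ) (y : Fin m → Bool) :
    ‖Complex.exp (2 * Real.pi * Complex.I * (θ - phaseValue y : ℝ)) - 1‖ * (2 ^ m *
      ‖phaseAmp m (Complex.exp (2 * Real.pi * Complex.I * θ)) y‖) ≤ 2 := by
  set z := Complex.exp (2 * Real.pi * Complex.I * (θ - phaseValue y : ℝ)) with hz
  have hnz : ‖z‖ = 1 := by
    rw [hz, show 2 * Real.pi * Complex.I * ((θ - phaseValue y : ℝ) : ℂ) =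
      ((2 * Real.pi * (θ - phaseValue y) : ℝ) : ℂ) * Complex.I by push_cast; ring,
      Complex.norm_exp_ofReal_mul_I]
  have h : (2 : ℂ) ^ m * phaseAmp m (Complex.exp (2 * Real.pi * Complex.I * θ)) y =
      ∏ k ∈ Finset.range m, (1 + z ^ 2 ^ k) := by
    change (2 : ℂ) ^ m * ∏ l, digitAmp _ l y = _
    simp only [digitAmp_exp, ← hz]
    rw [Finset.prod_div_distrib, Finset.prod_const, Finset.card_univ, Fintype.card_fin,
      mul_comm, div_mul_cancel₀ _ (pow_ne_zero m two_ne_zero), Fin.prod_univ_eq_prod_range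
        (fun i => 1 + z ^ 2 ^ (m - 1 - i)), Finset.prod_range_reflect (fun i => 1 + z ^ 2 ^ i)]
  have h2 : (2 : ℝ) ^ m = ‖(2 : ℂ) ^ m‖ := by simp
  rw [h2, ← norm_mul, ← norm_mul, h, sub_one_mul_prod_one_add]
  refine (norm_sub_le _ _).trans ?_
  rw [norm_pow, hnz]
  norm_num

/-- The norm is `2 |sin (π r)|` with `r` the fractional part, and Jordan's inequality bounds the
sine on each half of the period. -/
lemma norm_exp_sub_one_ge (x : ℝ) :
    4 * min (Int.fract x) (1 - Int.fract x) ≤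
      ‖Complex.exp (2 * Real.pi * Complex.I * x) - 1‖ := by
  have h : Complex.exp (2 * Real.pi * Complex.I * x) =
      Complex.exp (Complex.I * (2 * Real.pi * Int.fract x : ℝ)) := by
    rw [Complex.exp_eq_exp_iff_exists_int]
    refine ⟨⌊x⌋, ?_⟩
    have : (x : ℂ) = ⌊x⌋ + Int.fract x := by
      exact_mod_cast (Int.floor_add_fract x).symm
    push_cast
    rw [this]
    ring
  rw [h, Complex.norm_exp_I_mul_ofReal_sub_one]
  have h0 := Int.fract_nonneg x
  have h1 := Int.fract_lt_one x
  set r := Int.fract x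
  rw [show 2 * Real.pi * r / 2 = Real.pi * r by ring, norm_mul, Real.norm_ofNat]
  have hpi := Real.pi_pos
  have hsin : 2 * min r (1 - r) ≤ Real.sin (Real.pi * r) := by
    rcases le_total r (1 / 2) with hr | hr
    · rw [min_eq_left (by linarith)]
      have := Real.mul_le_sin (x := Real.pi * r) (by positivity) (by nlinarith)
      rwa [show 2 / Real.pi * (Real.pi * r) = 2 * r by field_simp] at this
    · rw [min_eq_right (by linarith)]
      have := Real.mul_le_sin (x := Real.pi * (1 - r))
        (mul_nonneg hpi.le (by linarith)) (by nlinarith)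
      rw [show 2 / Real.pi * (Real.pi * (1 - r)) = 2 * (1 - r) by field_simp,
        show Real.pi * (1 - r) = Real.pi - Real.pi * r by ring, Real.sin_pi_sub] at this
      exact this
  have := le_abs_self (Real.sin (Real.pi * r))
  rw [Real.norm_eq_abs]
  linarith

/-- Each digit preserves the total weight: once the other digits are fixed, its two values have the
factors `(1 ± w) / 2` with `‖w‖ = 1`, and the parallelogram law makes their squared norms add up to
`1`. -/
lemma norm_phaseAmp {ζ : ℂ} (hζ : ‖ζ‖ = 1) : ‖phaseAmp m ζ‖ = 1 := by
  let T : ℕ → (Fin m → Bool) → ℂ := fun k =>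
    digitsState (Embedding.refl (Fin m)) (fun _ : Fin 1 => ζ) k (fun _ _ => 1) 0
  have hstep : ∀ i : Fin m, ∑ y, ‖T (i + 1) y‖ ^ 2 = ∑ y, ‖T i y‖ ^ 2 := by
    intro i
    have hT : ∀ y, T (i + 1) y = digitAmp ζ i y * T i (update y i false) := fun y =>
      (digitsState_update (Embedding.refl (Fin m)) (fun _ _ => 1) i 0 y).symm
    have hT1 : ∀ y, T i (update y i true) = 0 := by
      intro y
      change digitsState _ _ _ _ _ _ = _
      rw [digitsState, if_neg]
      intro h
      simpa using h i le_rfl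
    apply mul_left_cancel₀ (two_ne_zero (α := ℝ))
    rw [← sum_update_add_sum_update _ i, ← sum_update_add_sum_update _ i]
    refine Finset.sum_congr rfl fun y _ => ?_
    rw [hT, hT, hT1, update_idem, update_idem, norm_mul, norm_mul, mul_pow, mul_pow, ← add_mul]
    set w := ζ ^ 2 ^ (m - 1 - i : ℕ) *
      ∏ l ∈ Finset.Iio i, if y l then turn l i else 1 with hw
    have hprod : ∀ b, (∏ l ∈ Finset.Iio i, if update y i b l then turn l i else 1) =
        ∏ l ∈ Finset.Iio i, if y l then turn l i else 1 := by
      intro b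
      refine Finset.prod_congr rfl fun l hl => ?_
      rw [update_of_ne (Finset.mem_Iio.1 hl).ne]
    have hwn : ‖w‖ = 1 := by
      rw [hw, norm_mul, norm_pow, hζ, one_pow, one_mul, norm_prod]
      refine Finset.prod_eq_one fun l _ => ?_
      split_ifs
      · exact norm_turn _ _
      · simp
    have h0 : digitAmp ζ i (update y i false) = (1 + w) / 2 := by
      rw [digitAmp, hprod, update_self, hw]; simp
    have h1 : digitAmp ζ i (update y i true) = (1 - w) / 2 := by
      rw [digitAmp, hprod, update_self, hw]; simp [sub_eq_add_neg]
    have hpar := parallelogram_law_with_norm ℝ (1 : ℂ) w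
    rw [hwn, norm_one] at hpar
    rw [h0, h1, norm_div, norm_div, Complex.norm_ofNat, div_pow, div_pow, norm_zero]
    have : ‖1 + w‖ ^ 2 / 2 ^ 2 + ‖1 - w‖ ^ 2 / 2 ^ 2 = 1 := by
      nlinarith [hpar]
    rw [this]
    ring
  have hall : ∀ k ≤ m, ∑ y, ‖T k y‖ ^ 2 = 1 := by
    intro k
    induction k with
    | zero =>
      intro _
      rw [Finset.sum_eq_single (fun _ => false)]
      · simp [T, digitsState]
      · intro y _ hy
        have : ¬ ∀ l, y l = false := fun h => hy (funext h)
        simp [T, digitsState, this]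
      · simp
    | succ k ih =>
      intro hk
      exact (hstep ⟨k, hk⟩).trans (ih (by omega))
  have hm := hall m le_rfl
  have hTm : ∀ y, T m y = phaseAmp m ζ y := by
    intro y
    simp only [T, digitsState, mul_one]
    rw [if_pos fun l hl => absurd l.2 (by omega)]
    change _ = ∏ l, digitAmp ζ l y
    refine Finset.prod_congr ?_ fun _ _ => rfl
    ext l
    simp
  simp only [hTm] at hm
  rw [← EuclideanSpace.norm_sq_eq] at hm
  exact (pow_eq_one_iff_of_nonneg (norm_nonneg _) two_ne_zero).1 hm

lemma sum_Ico_inv_sq_le {L : ℕ} (hL : 1 ≤ L) (M : ℕ) :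
    ∑ k ∈ Finset.Ico L M, ((k : ℝ) ^ 2)⁻¹ ≤ 2 / L := by
  have h := sum_Ioo_inv_sq_le (α := ℝ) (L - 1) M
  have hL' : ((L - 1 : ℕ) : ℝ) + 1 = L := by
    exact_mod_cast Nat.sub_add_cancel hL
  rw [hL'] at h
  refine le_trans (le_of_eq ?_) h
  congr 1
  ext k
  simp
  omega

-- An outcome with `2 ^ m * r` close to the integer `k` has squared amplitude of order `1 / k ^ 2`,
-- or the same with `k` counted from the other end of the circle. Different outcomes have different
-- `k`, and bad ones have `k` at least `L` from either end, so a tail of `∑ 1 / k ^ 2` bounds the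
-- weight.
open Classical in
lemma sum_norm_phaseAmp_sq_le (θ ε : ℝ) {L : ℕ} (hL : 1 ≤ L) (hε : L ≤ 2 ^ m * ε) :
    ∑ y : Fin m → Bool with ¬ ∃ z : ℤ, |phaseValue y - θ - z| ≤ ε,
      ‖phaseAmp m (Complex.exp (2 * Real.pi * Complex.I * θ)) y‖ ^ 2 ≤ 1 / L := by
  set r : (Fin m → Bool) → ℝ := fun y => Int.fract (θ - phaseValue y) with hr
  set bad : Finset (Fin m → Bool) :=
    {y : Fin m → Bool | ¬ ∃ z : ℤ, |phaseValue y - θ - z| ≤ ε} with hbad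
  have hN : (0 : ℝ) < 2 ^ m := by positivity
  have hbad₁ : ∀ y ∈ bad, ε < r y ∧ ε < 1 - r y := by
    intro y hy
    have hy' : ∀ z : ℤ, ε < |phaseValue y - θ - z| := by
      simpa [hbad] using hy
    have h0 := Int.fract_nonneg (θ - phaseValue y)
    have h1 := Int.fract_lt_one (θ - phaseValue y)
    have hfl := Int.floor_add_fract (θ - phaseValue y)
    constructor
    · have := hy' (-⌊θ - phaseValue y⌋)
      rwa [show phaseValue y - θ - ((-⌊θ - phaseValue y⌋ : ℤ) : ℝ) = -r y by
        push_cast; simp only [hr]; linarith, abs_neg, abs_of_nonneg h0] at this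
    · have := hy' (-⌊θ - phaseValue y⌋ - 1)
      rwa [show phaseValue y - θ - ((-⌊θ - phaseValue y⌋ - 1 : ℤ) : ℝ) = 1 - r y by
        push_cast; simp only [hr]; linarith, abs_of_pos (sub_pos.2 h1)] at this
  set κ : (Fin m → Bool) → ℕ := fun y => ⌊2 ^ m * r y⌋₊ with hκ
  have hκr : ∀ y, (κ y : ℝ) ≤ 2 ^ m * r y ∧ 2 ^ m * r y < κ y + 1 := fun y =>
    ⟨Nat.floor_le (mul_nonneg hN.le (Int.fract_nonneg _)), Nat.lt_floor_add_one _⟩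
  have hmem : ∀ y ∈ bad, κ y ∈ Finset.Ico L (2 ^ m - L) := by
    intro y hy
    obtain ⟨h₁, h₂⟩ := hbad₁ y hy
    have h₃ : (L : ℝ) < 2 ^ m * r y := hε.trans_lt (mul_lt_mul_of_pos_left h₁ hN)
    have h₄ : (L : ℝ) < 2 ^ m * (1 - r y) := hε.trans_lt (mul_lt_mul_of_pos_left h₂ hN)
    rw [Finset.mem_Ico]
    refine ⟨Nat.le_floor h₃.le, ?_⟩
    have h₅ : ((κ y + L : ℕ) : ℝ) < (2 ^ m : ℕ) := by
      push_cast
      linarith [(hκr y).1]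
    have := Nat.cast_lt.1 h₅
    omega
  -- The numbers `2 ^ m * r y` differ from `2 ^ m * θ - intValue y` by multiples of `2 ^ m`. Equal
  -- floors force two of them to coincide, hence `intValue` agrees modulo `2 ^ m`.
  have hinj : Function.Injective κ := by
    intro y y' h
    have h₁ := hκr y
    have h₂ := hκr y'
    rw [h] at h₁
    have hy : ∀ y, 2 ^ m * r y = 2 ^ m * θ - intValue y - 2 ^ m * ⌊θ - phaseValue y⌋ := by
      intro y
      have : 2 ^ m * phaseValue y = intValue y := by
        rw [phaseValue]; field_simp
      simp only [hr, Int.fract]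
      rw [← this]; ring
    rw [hy] at h₁ h₂
    set k := ⌊θ - phaseValue y⌋
    set k' := ⌊θ - phaseValue y'⌋
    have hlt : ((intValue y - intValue y' + 2 ^ m * (k - k') : ℤ) : ℝ) < 1 := by
      push_cast; linarith
    have hgt : (-1 : ℝ) < ((intValue y - intValue y' + 2 ^ m * (k - k') : ℤ) : ℝ) := by
      push_cast; linarith
    have hlt' : (intValue y - intValue y' + 2 ^ m * (k - k') : ℤ) < 1 := by exact_mod_cast hlt
    have hgt' : (-1 : ℤ) < (intValue y - intValue y' + 2 ^ m * (k - k') : ℤ) := by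
      exact_mod_cast hgt
    have hz : (intValue y - intValue y' + 2 ^ m * (k - k') : ℤ) = 0 := by omega
    have hmod : intValue y ≡ intValue y' [MOD 2 ^ m] := by
      rw [← Int.natCast_modEq_iff, Int.modEq_iff_dvd]
      refine ⟨k - k', ?_⟩
      push_cast
      linarith
    have := Nat.ModEq.eq_of_lt_of_lt hmod (intValue_lt y) (intValue_lt y')
    exact intValue_injective this
  -- Flooring gives `κ y ≤ 2 ^ m * r y` on one side and `2 ^ m - 1 - κ y ≤ 2 ^ m * (1 - r y)` on the
  -- other; adding both terms avoids splitting the sum by the nearer end.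
  have hterm : ∀ y ∈ bad, ‖phaseAmp m (Complex.exp (2 * Real.pi * Complex.I * θ)) y‖ ^ 2 ≤
      1 / 4 * (((κ y : ℝ) ^ 2)⁻¹ + (((2 ^ m - 1 - κ y : ℕ) : ℝ) ^ 2)⁻¹) := by
    intro y hy
    have hmem' := Finset.mem_Ico.1 (hmem y hy)
    have hk₁ : (0 : ℝ) < κ y := by exact_mod_cast (by omega : 0 < κ y)
    have hk₂ : (0 : ℝ) < (2 ^ m - 1 - κ y : ℕ) := by
      exact_mod_cast (by omega : 0 < 2 ^ m - 1 - κ y)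
    have hk₃ : ((2 ^ m - 1 - κ y : ℕ) : ℝ) = 2 ^ m - 1 - κ y := by
      rw [Nat.cast_sub (by omega), Nat.cast_sub (by omega)]
      push_cast; ring
    have hκy := hκr y
    have h₁ := norm_phaseAmp_mul_le θ y
    have h₂ := norm_exp_sub_one_ge (θ - phaseValue y)
    set A := ‖phaseAmp m (Complex.exp (2 * Real.pi * Complex.I * θ)) y‖ with hA
    have hA0 : 0 ≤ A := norm_nonneg _
    have h₃ : 4 * min (r y) (1 - r y) * (2 ^ m * A) ≤ 2 :=
      (mul_le_mul_of_nonneg_right h₂ (by positivity)).trans h₁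
    have hcase : ∀ c : ℝ, 0 < c → c * A ≤ 1 / 2 → A ^ 2 ≤ 1 / 4 * (c ^ 2)⁻¹ := by
      intro c hc hcA
      have : A ≤ 1 / 2 * c⁻¹ := by
        rw [← div_eq_mul_inv, le_div_iff₀ hc]; linarith
      calc A ^ 2 ≤ (1 / 2 * c⁻¹) ^ 2 := by gcongr
        _ = _ := by rw [mul_pow, inv_pow]; norm_num
    have hp₁ : (0 : ℝ) ≤ 1 / 4 * ((κ y : ℝ) ^ 2)⁻¹ := by positivity
    have hp₂ : (0 : ℝ) ≤ 1 / 4 * (((2 ^ m - 1 - κ y : ℕ) : ℝ) ^ 2)⁻¹ := by positivity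
    rw [mul_add]
    rcases le_total (r y) (1 - r y) with hc | hc
    · rw [min_eq_left hc] at h₃
      have := hcase (κ y) hk₁ (by nlinarith)
      linarith
    · rw [min_eq_right hc] at h₃
      have := hcase _ hk₂ (by rw [hk₃]; nlinarith)
      linarith
  calc _ ≤ ∑ y ∈ bad, 1 / 4 * (((κ y : ℝ) ^ 2)⁻¹ + (((2 ^ m - 1 - κ y : ℕ) : ℝ) ^ 2)⁻¹) :=
        Finset.sum_le_sum hterm
    _ = ∑ k ∈ bad.image κ, 1 / 4 * (((k : ℝ) ^ 2)⁻¹ + (((2 ^ m - 1 - k : ℕ) : ℝ) ^ 2)⁻¹) :=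
        (Finset.sum_image hinj.injOn (f := fun k : ℕ =>
          1 / 4 * (((k : ℝ) ^ 2)⁻¹ + (((2 ^ m - 1 - k : ℕ) : ℝ) ^ 2)⁻¹))).symm
    _ ≤ ∑ k ∈ Finset.Ico L (2 ^ m - L),
          1 / 4 * (((k : ℝ) ^ 2)⁻¹ + (((2 ^ m - 1 - k : ℕ) : ℝ) ^ 2)⁻¹) :=
        Finset.sum_le_sum_of_subset_of_nonneg (Finset.image_subset_iff.2 hmem)
          fun _ _ _ => by positivity
    _ = 1 / 4 * (∑ k ∈ Finset.Ico L (2 ^ m - L), ((k : ℝ) ^ 2)⁻¹ +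
          ∑ k ∈ Finset.Ico L (2 ^ m - L), ((k : ℝ) ^ 2)⁻¹) := by
        rw [← Finset.mul_sum, Finset.sum_add_distrib,
          Finset.sum_Ico_reflect (fun k : ℕ => ((k : ℝ) ^ 2)⁻¹) L (by omega)]
        have h1 : 1 ≤ 2 ^ m := Nat.one_le_two_pow
        rw [Nat.sub_add_cancel h1]
        rcases le_total L (2 ^ m) with h | h
        · rw [Nat.sub_sub_self h]
        · rw [Nat.sub_eq_zero_of_le h]
          simp
    _ ≤ 1 / 4 * (2 / L + 2 / L) := by
        gcongr <;> exact sum_Ico_inv_sq_le hL _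
    _ = 1 / L := by ring

-- Project onto the good outcomes and renormalize; each of the two steps moves the vector by at most
-- `δ / 2`.
open Classical in
lemma exists_unit_vector_near {ι : Type*} [Fintype ι] {A : EuclideanSpace ℂ ι} (hA : ‖A‖ = 1)
    (p : ι → Prop) {δ : ℝ} (hδ : 0 < δ) (hδ₁ : δ ≤ 1)
    (h : ∑ y with ¬ p y, ‖A y‖ ^ 2 ≤ (δ / 2) ^ 2) :
    ∃ Θ : EuclideanSpace ℂ ι, ‖Θ‖ = 1 ∧ (∀ y, Θ y ≠ 0 → p y) ∧ ‖A - Θ‖ ≤ δ := by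
  set B : EuclideanSpace ℂ ι := WithLp.toLp 2 fun y => if p y then A y else 0 with hB
  have hAB : ‖A - B‖ ≤ δ / 2 := by
    refine le_of_sq_le_sq ?_ (by positivity)
    rw [EuclideanSpace.norm_sq_eq]
    refine le_trans (le_of_eq ?_) h
    rw [Finset.sum_filter]
    refine Finset.sum_congr rfl fun y _ => ?_
    by_cases hy : p y <;> simp [hB, hy]
  have hd := abs_norm_sub_norm_le A B
  rw [hA] at hd
  have hBpos : 0 < ‖B‖ := by
    have := (abs_le.1 (hd.trans hAB)).2
    linarith
  refine ⟨(‖B‖⁻¹ : ℝ) • B, ?_, ?_, ?_⟩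
  · rw [norm_smul, norm_inv, norm_norm, inv_mul_cancel₀ hBpos.ne']
  · intro y hy
    by_contra hp
    simp [hB, hp] at hy
  · have : ‖B - (‖B‖⁻¹ : ℝ) • B‖ ≤ δ / 2 := by
      have hsm : B - (‖B‖⁻¹ : ℝ) • B = (1 - ‖B‖⁻¹ : ℝ) • B := by rw [sub_smul, one_smul]
      rw [hsm, norm_smul, Real.norm_eq_abs, ← abs_of_pos hBpos, ← abs_mul, abs_of_pos hBpos,
        sub_mul, inv_mul_cancel₀ hBpos.ne', one_mul, abs_sub_comm]
      exact hd.trans hAB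
    linarith [norm_sub_le_norm_sub_add_norm_sub A B ((‖B‖⁻¹ : ℝ) • B)]

end Tail

/-! ### Product states of the four registers. -/

section Registers

variable {n q m w : ℕ}

/-- The four registers of the machine. -/
def wireEquiv (q m w : ℕ) : (Wire q m w → Bool) ≃
    Bool × (Fin q → Bool) × (Fin m → Bool) × (Fin w → Bool) where
  toFun x := (x .block, fun i => x (.sing i), fun i => x (.phase i), fun i => x (.work i))
  invFun p := fun
    | .block => p.1
    | .sing i => p.2.1 i
    | .phase i => p.2.2.1 i
    | .work i => p.2.2.2 i
  left_inv x := by funext v; cases v <;> rfl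
  right_inv _ := rfl

/-- The coefficients of a product state whose block and work qubits are zero. -/
def productCoeff (w : ℕ) (β : Fin n → ℂ) (S : Fin n → EuclideanSpace ℂ (Fin q → Bool))
    (Θ : Fin n → EuclideanSpace ℂ (Fin m → Bool)) : Fin n → (Wire q m w → Bool) → ℂ := fun j x =>
  β j * ((if x .block then 0 else 1) * S j (fun i => x (.sing i)) * Θ j (fun i => x (.phase i)) *
    zeroKet w (fun i => x (.work i)))

lemma sum_smul_registerState (u : Fin n → EuclideanSpace ℂ (Fin n)) (β : Fin n → ℂ)
    (S : Fin n → EuclideanSpace ℂ (Fin q → Bool)) (Θ : Fin n → EuclideanSpace ℂ (Fin m → Bool)) :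
    ∑ j, β j • registerState w (u j) 0 (S j) (Θ j) = st u (productCoeff w β S Θ) := by
  ext ⟨r, x⟩
  simp only [WithLp.ofLp_sum, WithLp.ofLp_smul, Finset.sum_apply, Pi.smul_apply, smul_eq_mul,
    registerState, st, productCoeff]
  refine Finset.sum_congr rfl fun j _ => ?_
  split_ifs
  · simp
  · ring

lemma registerState_sum (u : Fin n → EuclideanSpace ℂ (Fin n)) (β : Fin n → ℂ)
    (S : EuclideanSpace ℂ (Fin q → Bool)) (Θ : EuclideanSpace ℂ (Fin m → Bool)) :
    registerState w (∑ j, β j • u j) 0 S Θ =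
      st u (productCoeff w β (fun _ => S) (fun _ => Θ)) := by
  rw [← sum_smul_registerState]
  ext ⟨r, x⟩
  simp only [WithLp.ofLp_sum, WithLp.ofLp_smul, Finset.sum_apply, Pi.smul_apply, smul_eq_mul,
    registerState]
  split_ifs <;> simp [Finset.sum_mul, mul_assoc]

lemma norm_zeroKet (k : ℕ) : ‖zeroKet k‖ = 1 := by simp [zeroKet]

lemma norm_st_productCoeff_sq {u : Fin n → EuclideanSpace ℂ (Fin n)} (hu : Orthonormal ℂ u)
    (β : Fin n → ℂ) (S : Fin n → EuclideanSpace ℂ (Fin q → Bool))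
    (Θ : Fin n → EuclideanSpace ℂ (Fin m → Bool)) :
    ‖st u (productCoeff w β S Θ)‖ ^ 2 = ∑ j, ‖β j‖ ^ 2 * (‖S j‖ ^ 2 * ‖Θ j‖ ^ 2) := by
  rw [norm_st_sq _ hu, Finset.sum_comm]
  refine Finset.sum_congr rfl fun j _ => ?_
  rw [← Equiv.sum_comp (wireEquiv q m w).symm]
  simp only [Fintype.sum_prod_type, Fintype.sum_bool, productCoeff, wireEquiv, Equiv.coe_fn_symm_mk,
    norm_mul, mul_pow]
  simp only [if_true, Bool.false_eq_true, if_false, norm_zero, norm_one, one_pow, one_mul,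
    ne_eq, OfNat.ofNat_ne_zero, not_false_eq_true, zero_pow, zero_mul, mul_zero,
    Finset.sum_const_zero, zero_add]
  have h := EuclideanSpace.norm_sq_eq (zeroKet w)
  rw [norm_zeroKet, one_pow] at h
  simp only [← Finset.mul_sum, ← h, mul_one, ← EuclideanSpace.norm_sq_eq]
  rw [← Finset.sum_mul, ← EuclideanSpace.norm_sq_eq]

lemma norm_st_productCoeff {u : Fin n → EuclideanSpace ℂ (Fin n)} (hu : Orthonormal ℂ u)
    (β : EuclideanSpace ℂ (Fin n)) {S : Fin n → EuclideanSpace ℂ (Fin q → Bool)}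
    {Θ : Fin n → EuclideanSpace ℂ (Fin m → Bool)} (hS : ∀ j, ‖S j‖ = 1) (hΘ : ∀ j, ‖Θ j‖ = 1) :
    ‖st u (productCoeff w β S Θ)‖ = ‖β‖ := by
  rw [← pow_left_inj₀ (norm_nonneg _) (norm_nonneg _) two_ne_zero, norm_st_productCoeff_sq hu,
    EuclideanSpace.norm_sq_eq]
  simp [hS, hΘ]

lemma norm_st_productCoeff_sub_le {u : Fin n → EuclideanSpace ℂ (Fin n)} (hu : Orthonormal ℂ u)
    (β : EuclideanSpace ℂ (Fin n)) {S : Fin n → EuclideanSpace ℂ (Fin q → Bool)}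
    {A Θ : Fin n → EuclideanSpace ℂ (Fin m → Bool)} {δ : ℝ} (hδ : 0 ≤ δ) (hS : ∀ j, ‖S j‖ = 1)
    (hΘ : ∀ j, ‖A j - Θ j‖ ≤ δ) :
    ‖st u (productCoeff w β S A) - st u (productCoeff w β S Θ)‖ ≤ δ * ‖β‖ := by
  have h : st u (productCoeff w β S A) - st u (productCoeff w β S Θ) =
      st u (productCoeff w β S fun j => A j - Θ j) := by
    rw [st_sub]
    congr 1
    funext j x
    simp only [productCoeff, Pi.sub_apply, PiLp.sub_apply]
    ring
  refine le_of_sq_le_sq ?_ (by positivity)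
  rw [h, norm_st_productCoeff_sq hu, mul_pow, EuclideanSpace.norm_sq_eq, Finset.mul_sum]
  refine Finset.sum_le_sum fun j _ => ?_
  rw [hS, one_pow, one_mul, mul_comm]
  gcongr
  exact hΘ j

end Registers

/-! ### The layout of the qubits and the whole circuit. -/

section Wires

/-- The number of work qubits of eigenvalue estimation: the work qubits of singular value
estimation, a second value register and two flags. -/
def workSize (q a : ℕ) : ℕ := Fintype.card (Fin a ⊕ Fin q ⊕ Bool)

/-- The parts of the work register. -/
def workWire (q m a : ℕ) (i : Fin a ⊕ Fin q ⊕ Bool) : Wire q m (workSize q a) :=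
  .work (Fintype.equivFin (Fin a ⊕ Fin q ⊕ Bool) i)

@[simp] lemma workWire_inj {q m a : ℕ} {i k : Fin a ⊕ Fin q ⊕ Bool} :
    workWire q m a i = workWire q m a k ↔ i = k :=
  ⟨fun h => (Fintype.equivFin _).injective (Wire.work.inj h), congrArg _⟩

@[simp] lemma workWire_ne_block {q m a : ℕ} {i : Fin a ⊕ Fin q ⊕ Bool} :
    workWire q m a i ≠ .block := by simp [workWire]

@[simp] lemma workWire_ne_sing {q m a : ℕ} {i : Fin a ⊕ Fin q ⊕ Bool} {k : Fin q} :
    workWire q m a i ≠ .sing k := by simp [workWire]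

@[simp] lemma block_ne_workWire {q m a : ℕ} {i : Fin a ⊕ Fin q ⊕ Bool} :
    .block ≠ workWire q m a i := workWire_ne_block.symm

@[simp] lemma sing_ne_workWire {q m a : ℕ} {i : Fin a ⊕ Fin q ⊕ Bool} {k : Fin q} :
    .sing k ≠ workWire q m a i := workWire_ne_sing.symm

@[simp] lemma workWire_ne_phase {q m a : ℕ} {i : Fin a ⊕ Fin q ⊕ Bool} {k : Fin m} :
    workWire q m a i ≠ .phase k := by simp [workWire]

/-- The qubits of singular value estimation, with the second value register. -/
def copyEmb (q m a : ℕ) : Wire q 0 a ↪ Wire q m (workSize q a) where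
  toFun
    | .block => .block
    | .sing i => workWire q m a (.inr (.inl i))
    | .phase i => i.elim0
    | .work i => workWire q m a (.inl i)
  inj' := by
    rintro (_ | i | i | i) (_ | k | k | k) h <;>
      first | exact i.elim0 | exact k.elim0 | simp_all

/-- The qubits of singular value estimation, with the value register. -/
def mainEmb (q m a : ℕ) : Wire q 0 a ↪ Wire q m (workSize q a) where
  toFun
    | .block => .block
    | .sing i => .sing i
    | .phase i => i.elim0
    | .work i => workWire q m a (.inl i)
  inj' := by
    rintro (_ | i | i | i) (_ | k | k | k) h <;>
      first | exact i.elim0 | exact k.elim0 | simp_all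

@[simp] lemma copyEmb_block (q m a : ℕ) : copyEmb q m a .block = .block := rfl

@[simp] lemma copyEmb_sing {q m a : ℕ} (i : Fin q) :
    copyEmb q m a (.sing i) = workWire q m a (.inr (.inl i)) := rfl

@[simp] lemma copyEmb_work {q m a : ℕ} (i : Fin a) :
    copyEmb q m a (.work i) = workWire q m a (.inl i) := rfl

@[simp] lemma mainEmb_block (q m a : ℕ) : mainEmb q m a .block = .block := rfl

@[simp] lemma mainEmb_sing {q m a : ℕ} (i : Fin q) : mainEmb q m a (.sing i) = .sing i := rfl

@[simp] lemma mainEmb_work {q m a : ℕ} (i : Fin a) :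
    mainEmb q m a (.work i) = workWire q m a (.inl i) := rfl

/-- The qubits of the phase register. -/
def phaseEmb (q m w : ℕ) : Fin m ↪ Wire q m w := ⟨.phase, fun _ _ => Wire.phase.inj⟩

@[simp] lemma phaseEmb_apply {q m w : ℕ} (i : Fin m) : phaseEmb q m w i = .phase i := rfl

variable {P : Primitives} {q a : ℕ}

/-- Eigenvalue estimation for normal matrices. -/
def eigC (V : Circuit P (Wire q 0 a)) (t : Fin q) (m : ℕ) :
    Circuit P (Wire q m (workSize q a)) :=
  digitsC V (copyEmb q m a) t (workWire q m a (.inr (.inr false))) (phaseEmb q m _) m ++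
    appendC V (copyEmb q m a) (mainEmb q m a) t (workWire q m a (.inr (.inr true)))

lemma time_eigC (V : Circuit P (Wire q 0 a)) (t : Fin q) (m : ℕ) :
    Circuit.time (eigC V t m) ≤ 2 ^ m * (15 * V.time + 19) := by
  rw [eigC, Circuit.time_append]
  have h₁ := time_digitsC_le V (copyEmb q m a) t (workWire q m a (.inr (.inr false)))
    (phaseEmb q m _)
  have h₂ := time_appendC V (copyEmb q m a) (mainEmb q m a) t
    (workWire q m a (.inr (.inr true)))
  have h₃ : 1 * (5 * V.time + 6) ≤ 2 ^ m * (5 * V.time + 6) :=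
    Nat.mul_le_mul_right _ Nat.one_le_two_pow
  linarith

variable {n : ℕ} {I : P.Interpretation n} {V : Circuit P (Wire q 0 a)}
  {u v : Fin n → EuclideanSpace ℂ (Fin n)} {ζ : Fin n → ℂ} {f : Fin n → Bool}
  {S : Fin n → Bool → EuclideanSpace ℂ (Fin q → Bool)} {t : Fin q} {η : ℝ}

lemma productCoeff_zeroKet (w m : ℕ) (β : Fin n → ℂ) (j : Fin n) (x : Wire q m w → Bool) :
    productCoeff w β (fun _ => zeroKet q) (fun _ => zeroKet m) j x =
      if ∀ i, x i = false then β j else 0 := by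
  have h : (∀ i, x i = false) ↔ x .block = false ∧ (∀ i, x (.sing i) = false) ∧
      (∀ i, x (.phase i) = false) ∧ ∀ i, x (.work i) = false :=
    ⟨fun h => ⟨h _, fun _ => h _, fun _ => h _, fun _ => h _⟩, fun h i => by
      cases i
      exacts [h.1, h.2.1 _, h.2.2.1 _, h.2.2.2 _]⟩
  simp only [productCoeff, zeroKet_apply, h]
  by_cases h₁ : x .block = false <;> by_cases h₂ : ∀ i, x (.sing i) = false <;>
    by_cases h₃ : ∀ i, x (.phase i) = false <;> by_cases h₄ : ∀ i, x (.work i) = false <;>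
    simp [h₁, h₂, h₃, h₄]

/-- All reflections use the second value register, so phase estimation leaves the output register
untouched until the estimate is appended. The errors `2 ^ m * (10 * η)` and `5 * η` are merged by `1
≤ 2 ^ m`. -/
lemma EstimatesSign.approx_eigC (hV : EstimatesSign I V u v ζ f S t η) (hη : 0 ≤ η)
    (hS : ∀ j, ‖S j true‖ = 1) (hf : ∀ j, f j = false → ζ j = 1) (m : ℕ) (β : Fin n → ℂ) :
    Approx I (eigC V t m) (2 ^ m * (15 * η))
      (st u (productCoeff _ β (fun _ => zeroKet q) (fun _ => zeroKet m)))
      (st u (productCoeff _ β (fun j => S j true) fun j => phaseAmp m (ζ j))) := by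
  set χ : Fin n → (Wire q m (workSize q a) → Bool) → ℂ :=
    productCoeff _ β (fun _ => zeroKet q) (fun _ => zeroKet m) with hχdef
  have hχ0 : ∀ j x, χ j x = if ∀ i, x i = false then β j else 0 := fun j x =>
    productCoeff_zeroKet _ _ β j x
  have hχne : ∀ j x, χ j x ≠ 0 → ∀ i, x i = false := by
    intro j x h
    by_contra hx
    exact h (by rw [hχ0, if_neg hx])
  have hχz : ∀ i j x, x i = true → χ j x = 0 := by
    intro i j x hx
    by_contra h
    simp [hχne j x h i] at hx
  set χ' : Fin n → (Wire q m (workSize q a) → Bool) → ℂ := fun j x =>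
    (∏ l, digitAmp (ζ j) l (x ∘ phaseEmb q m _)) *
      χ j (extend (phaseEmb q m _) (fun _ => false) x) with hχ'
  have hext : ∀ (x : Wire q m (workSize q a) → Bool) i, (∀ k, i ≠ .phase k) →
      extend (phaseEmb q m _) (fun _ => false) x i = x i := fun x i hi =>
    extend_apply' _ _ _ (by rintro ⟨k, hk⟩; exact hi k hk.symm)
  have hχ'ne : ∀ j x, χ' j x ≠ 0 → ∀ i, (∀ k, i ≠ .phase k) → x i = false := by
    intro j x h i hi
    rw [← hext x i hi]
    exact hχne j _ (right_ne_zero_of_mul h) i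
  have hχ'z : ∀ i, (∀ k, i ≠ .phase k) → ∀ j x, x i = true → χ' j x = 0 := by
    intro i hi j x hx
    by_contra h
    simp [hχ'ne j x h i hi] at hx
  have h₁ := hV.approx_phaseEstimation hη hf (copyEmb q m a)
    (g := workWire q m a (.inr (.inr false))) (phaseEmb q m _)
    (by
      rintro (_ | i | i | i)
      · simp
      · simp
      · exact i.elim0
      · simp)
    (by
      rintro (_ | i | i | i) k
      · simp
      · simp
      · exact i.elim0
      · simp)
    (by simp) χ
    (fun j x hx => ⟨fun i => hχne j x hx _, fun i => hχne j x hx _⟩)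
    (hχz _) (hχz _) (fun j x i => hχz _ j x)
  have h₂ := hV.approx_appendC hη hS (copyEmb q m a) (mainEmb q m a) rfl
    (by
      rintro (_ | i | i | i) k
      · simp
      · simp
      · exact i.elim0
      · simp) (h := workWire q m a (.inr (.inr true)))
    (by
      rintro (_ | i | i | i)
      · simp
      · simp
      · exact i.elim0
      · simp)
    (by
      rintro (_ | i | i | i)
      · simp
      · simp
      · exact i.elim0
      · simp) χ'
    (fun j x hx => ⟨fun i => hχ'ne j x hx _ (by simp),
      fun i => hχ'ne j x hx _ (by simp)⟩)
    (fun j x hx => ⟨fun i => hχ'ne j x hx _ (by simp),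
      fun i => hχ'ne j x hx _ (by simp)⟩)
    (hχ'z _ (by simp)) (hχ'z _ (by simp))
  refine ((h₁.append h₂).of_eq rfl ?_).mono ?_
  · congr 1
    funext j x
    have hz : extend (phaseEmb q m _) (fun _ => false)
        (extend (singEmb (mainEmb q m a)) (fun _ => false) x) =
        fun i => match i with
          | .block => x .block
          | .sing _ => false
          | .phase _ => false
          | .work i => x (.work i) := by
      funext i
      cases i with
      | block =>
        rw [hext _ _ (by simp), extend_apply']
        rintro ⟨k, hk⟩
        cases hk
      | sing i =>
        rw [hext _ _ (by simp)]
        exact (singEmb (mainEmb q m a)).injective.extend_apply _ _ i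
      | phase i => exact (phaseEmb q m _).injective.extend_apply _ _ i
      | work i =>
        rw [hext _ _ (by simp), extend_apply']
        rintro ⟨k, hk⟩
        cases hk
    have hph : extend (singEmb (mainEmb q m a)) (fun _ => false) x ∘ phaseEmb q m _ =
        fun i => x (.phase i) := by
      funext i
      refine extend_apply' _ _ _ ?_
      rintro ⟨k, hk⟩
      cases hk
    have hs : x ∘ singEmb (mainEmb q m a) = fun i => x (.sing i) := rfl
    simp only [appended, hχ', hz, hph, hs, hχdef, productCoeff]
    simp only [zeroKet_apply q, zeroKet_apply m, implies_true, if_true]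
    change _ = β j * (_ * _ * (∏ l, digitAmp (ζ j) l fun i => x (.phase i)) * _)
    ring
  · have : (1 : ℝ) ≤ 2 ^ m := one_le_pow₀ one_le_two
    nlinarith

end Wires

/-! ### From the assumptions on `M` to the circuit, and the degenerate cases. -/

section Main

variable {P : Primitives} {n q m a : ℕ} {I : P.Interpretation n}

lemma signedValue_nonneg {C : ℝ} (hC : 0 < C) {x : Fin q → Bool} (h : 2 * intValue x < 2 ^ q) :
    0 ≤ signedValue C x := by
  rw [signedValue, if_pos h]
  positivity

/-- A single qubit carries the sign, so no comparison circuit is needed; this requires at least one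
qubit in the register. -/
lemma signedValue_neg_iff {C : ℝ} (hC : 0 < C) (x : Fin (q + 1) → Bool) :
    signedValue C x < 0 ↔ x (Fin.last q) = true := by
  rw [top_digit_iff]
  constructor
  · intro h
    by_contra hx
    exact absurd h (not_lt.2 (signedValue_nonneg hC (not_le.1 hx)))
  · intro h
    have hlt : (intValue x : ℝ) < 2 ^ (q + 1) := by exact_mod_cast intValue_lt x
    rw [signedValue, if_neg (not_lt.2 h), neg_lt_zero]
    have := sub_pos.2 hlt
    positivity

/-- Pairing both expansions of `M` with `u j` from the left isolates the `j`th term; then `σ j`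
cancels. -/
lemma IsSVD.right_eq {M : Matrix (Fin n) (Fin n) ℂ} {σ θ : Fin n → ℝ}
    {u v : Fin n → EuclideanSpace ℂ (Fin n)} (hE : IsEigenDecomposition M σ θ u)
    (hM : IsSVD M σ u v) {j : Fin n} (hj : σ j ≠ 0) :
    v j = star (Complex.exp (2 * Real.pi * Complex.I * (θ j : ℂ))) • u j := by
  have key : ∀ (α : Fin n → ℂ) (w : Fin n → EuclideanSpace ℂ (Fin n)) (c : Fin n),
      ∑ r, star (u j r) * ∑ k, α k * (u k r * star (w k c)) = α j * star (w j c) := by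
    intro α w c
    simp only [Finset.mul_sum]
    rw [Finset.sum_comm]
    have : ∀ k, ∑ r, star (u j r) * (α k * (u k r * star (w k c))) =
        α k * star (w k c) * inner ℂ (u j) (u k) := by
      intro k
      rw [PiLp.inner_apply, Finset.mul_sum]
      refine Finset.sum_congr rfl fun r _ => ?_
      simp only [RCLike.inner_apply, Complex.star_def]
      ring
    simp only [this, orthonormal_iff_ite.1 hE.orthonormal]
    simp
  ext c
  have h₁ := key (fun k => (σ k : ℂ) * Complex.exp (2 * Real.pi * Complex.I * (θ k : ℂ))) u c
  have h₂ := key (fun k => (σ k : ℂ)) v c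
  simp only [← hE.eq_sum, ← hM.eq_sum] at h₁ h₂
  rw [h₁, mul_assoc] at h₂
  have h₃ := mul_left_cancel₀ (Complex.ofReal_ne_zero.2 hj) h₂
  have h₄ := congrArg star h₃
  rw [star_star, star_mul, star_star] at h₄
  rw [← h₄, PiLp.smul_apply, smul_eq_mul, mul_comm]

/-- The phase of the eigenvalue `j`, or `0` if the eigenvalue vanishes. -/
def phaseOf (σ θ : Fin n → ℝ) (j : Fin n) : ℝ := if σ j = 0 then 0 else θ j

open Classical in
lemma estimatesSign_of_implementsQSVE {V : Circuit P (Wire (q + 1) 0 a)}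
    {M : Matrix (Fin n) (Fin n) ℂ} {σ θ : Fin n → ℝ} {u v : Fin n → EuclideanSpace ℂ (Fin n)}
    {C ε η : ℝ} (hE : IsEigenDecomposition M σ θ u) (hM : IsSVD M σ u v) (hC : 0 < C)
    {S : Fin n → Bool → EuclideanSpace ℂ (Fin (q + 1) → Bool)}
    (hS : ∀ j s x, S j s x ≠ 0 → |signedValue C x - sgn s * σ j| ≤ ε ∧
      (signedValue C x < 0 ↔ sgn s * σ j < 0))
    (hS0 : ∀ j, σ j = 0 → S j true = S j false)
    (hV : ∀ β : EuclideanSpace ℂ (Fin n × Bool),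
      ‖V.run I (∑ j, ∑ s, (β (j, s) * (1 / Real.sqrt 2 : ℝ)) •
            registerState a (u j) ((sgn s : ℂ) • v j) (zeroKet (q + 1)) (zeroKet 0)) -
          ∑ j, ∑ s, (β (j, s) * (1 / Real.sqrt 2 : ℝ)) •
            registerState a (u j) ((sgn s : ℂ) • v j) (S j s) (zeroKet 0)‖ ≤ η * ‖β‖) :
    EstimatesSign I V u v
      (fun j => Complex.exp (2 * Real.pi * Complex.I * (phaseOf σ θ j : ℂ)))
      (fun j => decide (σ j ≠ 0)) S (Fin.last q) η where
  orthonormal := hE.orthonormal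
  norm_phase j := by
    rw [show 2 * Real.pi * Complex.I * (phaseOf σ θ j : ℂ) =
      ((2 * Real.pi * phaseOf σ θ j : ℝ) : ℂ) * Complex.I by push_cast; ring,
      Complex.norm_exp_ofReal_mul_I]
  right_eq j hj := by
    have hj' : σ j ≠ 0 := of_decide_eq_true hj
    simp only [phaseOf, hj', if_false]
    exact hM.right_eq hE hj'
  sign_iff j s y hj hy := by
    have hj' : 0 < σ j := lt_of_le_of_ne (hE.nonneg j) (Ne.symm (of_decide_eq_true hj))
    rw [← signedValue_neg_iff hC, (hS j s y hy).2]
    cases s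
    · simpa [sgn] using hj'
    · simpa [sgn] using hj'.le
  sign_eq j s y hj hy := by
    have hj' : σ j = 0 := by simpa using hj
    have := (hS j s y hy).2
    rw [signedValue_neg_iff hC, hj', mul_zero] at this
    simpa using this
  eq_of_zero j hj := hS0 j (by simpa using hj)
  norm_sub_le := hV

/-- The choice `4 / δ ^ 2 ≤ L` makes the bad weight `1 / L` at most `(δ / 2) ^ 2`. -/
lemma exists_phase_state {δ : ℝ} (hδ : 0 < δ) (hδ₁ : δ ≤ 1) {L : ℕ} (hL : 4 / δ ^ 2 ≤ L) {ε : ℝ}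
    (hε : L ≤ 2 ^ m * ε) (θ : ℝ) :
    ∃ Θ : EuclideanSpace ℂ (Fin m → Bool), ‖Θ‖ = 1 ∧
      (∀ y, Θ y ≠ 0 → ∃ z : ℤ, |phaseValue y - θ - z| ≤ ε) ∧
      ‖phaseAmp m (Complex.exp (2 * Real.pi * Complex.I * (θ : ℂ))) - Θ‖ ≤ δ := by
  have hpos : (0 : ℝ) < L := lt_of_lt_of_le (by positivity) hL
  have hL1 : 1 ≤ L := by exact_mod_cast hpos
  refine exists_unit_vector_near (norm_phaseAmp ?_) _ hδ hδ₁ ?_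
  · rw [show 2 * Real.pi * Complex.I * (θ : ℂ) = ((2 * Real.pi * θ : ℝ) : ℂ) * Complex.I by
      push_cast; ring, Complex.norm_exp_ofReal_mul_I]
  · refine (sum_norm_phaseAmp_sq_le θ ε hL1 hε).trans ?_
    rw [div_le_iff₀ (by positivity)] at hL
    rw [div_le_iff₀ hpos, div_pow]
    linarith

lemma implementsEigenvalueEstimation_eigC {V : Circuit P (Wire (q + 1) 0 a)}
    {M : Matrix (Fin n) (Fin n) ℂ} {σ θ : Fin n → ℝ} {u v : Fin n → EuclideanSpace ℂ (Fin n)}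
    {C ε₁ ε₂ η δ : ℝ} (hE : IsEigenDecomposition M σ θ u) (hM : IsSVD M σ u v) (hC : 0 < C)
    (hη : 0 ≤ η) (hV : ImplementsQSVE I V C σ u v ε₁ η) (hδ : 0 < δ) (hδ₁ : δ ≤ 1) {L : ℕ}
    (hL : 4 / δ ^ 2 ≤ L) (hε : L ≤ 2 ^ m * ε₂) :
    ImplementsEigenvalueEstimation I (eigC V (Fin.last q) m) C σ θ u ε₁ ε₂
      (2 ^ m * (15 * η) + δ) := by
  classical
  obtain ⟨S, hS1, hS, hS0, hrun⟩ := hV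
  have hES := estimatesSign_of_implementsQSVE hE hM hC hS hS0 hrun
  choose Θ hΘ1 hΘ hΘd using fun j => exists_phase_state hδ hδ₁ hL hε (phaseOf σ θ j)
  refine ⟨fun j => S j true, Θ, fun j => ⟨hS1 j true, fun x hx => ?_⟩,
    fun j => ⟨hΘ1 j, fun hj y hy => ?_⟩, fun β => ?_⟩
  · simpa [sgn] using (hS j true x hx).1
  · simpa [phaseOf, hj] using hΘ j y hy
  · have h := (hES.approx_eigC hη (fun j => hS1 j true)
      (fun j hj => by
        have hj' : σ j = 0 := by simpa using hj
        simp [phaseOf, hj']) m β).1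
    rw [norm_st_productCoeff hE.orthonormal β (fun _ => norm_zeroKet _)
      (fun _ => norm_zeroKet _)] at h
    rw [registerState_sum, sum_smul_registerState, add_mul]
    refine (norm_sub_le_norm_sub_add_norm_sub _ _ _).trans (add_le_add h ?_)
    exact norm_st_productCoeff_sub_le hE.orthonormal β hδ.le (fun j => hS1 j true) hΘd

/-- The empty circuit leaves the value register in zero, which stands for a nonnegative number,
whereas the estimate of `-σ j` has no amplitude there. Already the component with all qubits zero
shows a squared error of `1 / 2`. -/
lemma half_le_of_implementsQSVE_nil {σ : Fin n → ℝ} {u v : Fin n → EuclideanSpace ℂ (Fin n)}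
    {C ε η : ℝ} (hu : Orthonormal ℂ u) (hC : 0 < C) (hη : 0 ≤ η)
    (h : ImplementsQSVE I ([] : Circuit P (Wire q 0 a)) C σ u v ε η) {j : Fin n} (hj : 0 < σ j) :
    1 / 2 ≤ η := by
  obtain ⟨S, hS1, hS, hS0, hrun⟩ := h
  have h0 : S j false (fun _ => false) = 0 := by
    by_contra hne
    have h₁ := (hS j false _ hne).2.2 (by simpa [sgn] using hj)
    have h₂ := signedValue_nonneg hC (x := fun _ : Fin q => false) (by simp [intValue])
    linarith
  have hβ := hrun (EuclideanSpace.single (j, false) 1)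
  rw [Circuit.run_nil, PiLp.norm_single, norm_one, mul_one] at hβ
  set D : St n (Wire q 0 a) := _ - _ with hD
  have hent : ∀ r, D (r, fun _ => false) = ((1 / Real.sqrt 2 : ℝ) : ℂ) * u j r := by
    intro r
    have hsing : ∀ p : Fin n × Bool, (EuclideanSpace.single (j, false) (1 : ℂ)) p =
        if p = (j, false) then 1 else 0 := fun p => by simp
    have hz : ∀ k, zeroKet k (fun _ => false) = 1 := fun k => by simp [zeroKet_apply]
    simp only [hD, WithLp.ofLp_sub, Pi.sub_apply, WithLp.ofLp_sum, WithLp.ofLp_smul,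
      Finset.sum_apply, Pi.smul_apply, smul_eq_mul, registerState, hsing, Fintype.sum_bool,
      WithLp.ofLp_add, Pi.add_apply, Prod.mk.injEq, hz, mul_one, Bool.false_eq_true, if_false]
    simp [h0]
  have hsum : 1 / 2 ≤ ‖D‖ ^ 2 := by
    rw [EuclideanSpace.norm_sq_eq, Fintype.sum_prod_type]
    calc (1 / 2 : ℝ) = ∑ r, ‖D (r, fun _ => false)‖ ^ 2 := by
          simp only [hent, norm_mul, mul_pow]
          rw [← Finset.mul_sum, ← EuclideanSpace.norm_sq_eq, hu.1, Complex.norm_real,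
            Real.norm_eq_abs, sq_abs, div_pow, Real.sq_sqrt zero_le_two]
          norm_num
      _ ≤ _ := Finset.sum_le_sum fun r _ =>
          Finset.single_le_sum (f := fun x => ‖D (r, x)‖ ^ 2) (fun _ _ => by positivity)
            (Finset.mem_univ _)
  have := pow_le_pow_left₀ (norm_nonneg D) hβ 2
  nlinarith

/-- A register without qubits holds only the value `0` and cannot represent a negative estimate. -/
lemma eq_zero_of_implementsQSVE_zero {σ : Fin n → ℝ} {u v : Fin n → EuclideanSpace ℂ (Fin n)}
    {C ε η : ℝ} (hσ : ∀ j, 0 ≤ σ j) (hC : 0 < C) {V : Circuit P (Wire 0 0 a)}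
    (h : ImplementsQSVE I V C σ u v ε η) (j : Fin n) : σ j = 0 := by
  obtain ⟨S, hS1, hS, -, -⟩ := h
  have hne : S j false ≠ 0 := by
    intro h
    simpa [h] using hS1 j false
  obtain ⟨x, hx⟩ : ∃ x, S j false x ≠ 0 := by
    by_contra hx
    push Not at hx
    exact hne (by ext x; exact hx x)
  by_contra hj
  have hpos : 0 < σ j := lt_of_le_of_ne (hσ j) (Ne.symm hj)
  have h₁ := (hS j false x hx).2.2 (by simpa [sgn] using hpos)
  have h₂ := signedValue_nonneg hC (x := x) (by simp [intValue])
  linarith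

lemma implementsEigenvalueEstimation_nil_of_eq_zero {σ θ : Fin n → ℝ}
    {u : Fin n → EuclideanSpace ℂ (Fin n)} {C ε₁ ε₂ e : ℝ} (hε₁ : 0 < ε₁) (he : 0 ≤ e)
    (hσ : ∀ j, σ j = 0) :
    ImplementsEigenvalueEstimation I ([] : Circuit P (Wire q m a)) C σ θ u ε₁ ε₂ e := by
  refine ⟨fun _ => zeroKet q, fun _ => zeroKet m, fun j => ⟨norm_zeroKet q, fun x hx => ?_⟩,
    fun j => ⟨norm_zeroKet m, fun hj => absurd (hσ j) hj⟩, fun β => ?_⟩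
  · have hx0 : ∀ i, x i = false := by
      by_contra h
      exact hx (by rw [zeroKet_apply, if_neg h])
    have hint : intValue x = 0 := by simp [intValue, hx0]
    simp [signedValue, hint, hσ, hε₁.le]
  · rw [Circuit.run_nil, registerState_sum, sum_smul_registerState, sub_self, norm_zero]
    positivity

/-- The initial and the desired state both have norm `‖β‖`, so an allowed error of `2` is no
condition on the circuit. -/
lemma implementsEigenvalueEstimation_nil {V : Circuit P (Wire q 0 a)} {σ θ : Fin n → ℝ}
    {u v : Fin n → EuclideanSpace ℂ (Fin n)} {w : ℕ} {C ε₁ ε₂ η e δ : ℝ} (hu : Orthonormal ℂ u)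
    (hV : ImplementsQSVE I V C σ u v ε₁ η) (hδ : 0 < δ) (hδ₁ : δ ≤ 1) {L : ℕ}
    (hL : 4 / δ ^ 2 ≤ L) (hε : L ≤ 2 ^ m * ε₂) (he : 2 ≤ e) :
    ImplementsEigenvalueEstimation I ([] : Circuit P (Wire q m w)) C σ θ u ε₁ ε₂ e := by
  obtain ⟨S, hS1, hS, -, -⟩ := hV
  choose Θ hΘ1 hΘ hΘd using fun j => exists_phase_state hδ hδ₁ hL hε (θ j)
  refine ⟨fun j => S j true, Θ, fun j => ⟨hS1 j true, fun x hx => ?_⟩,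
    fun j => ⟨hΘ1 j, fun _ => hΘ j⟩, fun β => ?_⟩
  · simpa [sgn] using (hS j true x hx).1
  · rw [Circuit.run_nil, registerState_sum, sum_smul_registerState]
    refine (norm_sub_le _ _).trans ?_
    rw [norm_st_productCoeff hu β (fun _ => norm_zeroKet _) (fun _ => norm_zeroKet _),
      norm_st_productCoeff hu β (fun j => hS1 j true) hΘ1, ← two_mul]
    gcongr

lemma Circuit.one_le_time {Q : Type} {c : Circuit P Q} (hc : c ≠ []) : 1 ≤ c.time := by
  cases c with
  | nil => exact absurd rfl hc
  | cons g c =>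
    have := g.one_le_time
    rw [Circuit.time_cons]
    omega

lemma exists_two_pow_near {x : ℝ} (hx : 1 ≤ x) : ∃ m : ℕ, x ≤ 2 ^ m ∧ (2 : ℝ) ^ m ≤ 2 * x := by
  obtain ⟨k, h₁, h₂⟩ := exists_nat_pow_near hx one_lt_two
  exact ⟨k + 1, h₂.le, by rw [pow_succ]; linarith⟩

lemma ImplementsEigenvalueEstimation.mono {c : Circuit P (Wire q m a)} {σ θ : Fin n → ℝ}
    {u : Fin n → EuclideanSpace ℂ (Fin n)} {C ε₁ ε₂ e e' : ℝ}
    (h : ImplementsEigenvalueEstimation I c C σ θ u ε₁ ε₂ e) (he : e ≤ e') :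
    ImplementsEigenvalueEstimation I c C σ θ u ε₁ ε₂ e' := by
  obtain ⟨S, Θ, hS, hΘ, hrun⟩ := h
  exact ⟨S, Θ, hS, hΘ, fun β => (hrun β).trans (by gcongr)⟩

end Main

end QEig

end

theorem theorem4p1 (K δ : ℝ) (hK : 0 < K) (hδ : 0 < δ) :
    ∃ B : ℝ, 0 < B ∧
      ∀ (P : QEig.Primitives) (q a : ℕ) (qsve : QEig.Circuit P (QEig.Wire q 0 a)) (T ε₁ ε₂ : ℝ),
        0 < ε₁ → ε₁ < 1 → 0 < ε₂ → ε₂ < 1 →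
        (qsve.time : ℝ) ≤ K * (T / ε₁) →
        ∃ (m w : ℕ) (alg : QEig.Circuit P (QEig.Wire q m w)),
          (alg.time : ℝ) ≤ B * (T / (ε₁ * ε₂)) ∧
          ∀ (n : ℕ) (I : P.Interpretation n) (M : Matrix (Fin n) (Fin n) ℂ) (σ θ : Fin n → ℝ)
            (u v : Fin n → EuclideanSpace ℂ (Fin n)) (C η : ℝ),
            IsStarNormal M →
            QEig.IsEigenDecomposition M σ θ u →
            QEig.IsSVD M σ u v →
            0 < C → 0 ≤ η →
            QEig.ImplementsQSVE I qsve C σ u v ε₁ η →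
            QEig.ImplementsEigenvalueEstimation I alg C σ θ u ε₁ ε₂ (δ + B * (η / ε₂)) := by
  classical
  -- The renormalization of the phase states needs `δ ≤ 1`.
  set δ' := min δ 1 with hδ'def
  have hδ' : 0 < δ' := lt_min hδ one_pos
  obtain ⟨L, hL⟩ := exists_nat_ge (4 / δ' ^ 2)
  have hLpos : (0 : ℝ) < L := lt_of_lt_of_le (by positivity) hL
  have hL1 : (1 : ℝ) ≤ L := by exact_mod_cast Nat.one_le_iff_ne_zero.2 (by
    rintro rfl
    simp at hLpos)
  -- The first term is for the running time, the second for the error `2 ^ m * (15 * η)`, and the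
  -- `4` makes the claim trivial as soon as `1 / 2 ≤ η`.
  refine ⟨68 * L * K + 30 * L + 4, by positivity, ?_⟩
  intro P q a V T ε₁ ε₂ hε₁ _ hε₂ hε₂' htime
  obtain ⟨m, hm₁, hm₂⟩ := QEig.exists_two_pow_near (x := L / ε₂) (by
    rw [le_div_iff₀ hε₂]; linarith)
  have hε : (L : ℝ) ≤ 2 ^ m * ε₂ := (div_le_iff₀ hε₂).1 hm₁
  have hT : 0 ≤ T / ε₁ := by
    have : 0 ≤ K * (T / ε₁) := (Nat.cast_nonneg _).trans htime
    exact nonneg_of_mul_nonneg_right this hK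
  have hTε : T / (ε₁ * ε₂) = T / ε₁ / ε₂ := by rw [div_div]
  have hT' : 0 ≤ T / ε₁ / ε₂ := div_nonneg hT hε₂.le
  -- Without a value qubit there is no sign digit. If `V` is empty, `T` may be `0`, and then no time
  -- is allowed for the overhead either. In both cases the empty circuit suffices.
  by_cases htriv : q = 0 ∨ V = []
  · refine ⟨m, 0, [], ?_, ?_⟩
    · rw [QEig.Circuit.time_nil, hTε, Nat.cast_zero]
      positivity
    · intro n I M σ θ u v C η _ hE hM hC hη hV
      have hηε : η ≤ η / ε₂ := le_div_self hη hε₂ hε₂'.le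
      have he : 0 ≤ δ + (68 * L * K + 30 * L + 4) * (η / ε₂) := by positivity
      by_cases hσ : ∀ j, σ j = 0
      · exact QEig.implementsEigenvalueEstimation_nil_of_eq_zero hε₁ he hσ
      push Not at hσ
      obtain ⟨j, hj⟩ := hσ
      rcases htriv with rfl | rfl
      · exact absurd (QEig.eq_zero_of_implementsQSVE_zero hE.nonneg hC hV j) hj
      · have hη₂ := QEig.half_le_of_implementsQSVE_nil hE.orthonormal hC hη hV
          (lt_of_le_of_ne (hE.nonneg j) (Ne.symm hj))
        refine QEig.implementsEigenvalueEstimation_nil hE.orthonormal hV hδ' (min_le_right _ _)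
          hL hε ?_
        have h₁ : 4 * (η / ε₂) ≤ (68 * L * K + 30 * L + 4) * (η / ε₂) := by
          gcongr
          have : 0 ≤ 68 * L * K + 30 * L := by positivity
          linarith
        linarith
  · push Not at htriv
    obtain ⟨hq, hVne⟩ := htriv
    obtain ⟨q, rfl⟩ := Nat.exists_eq_succ_of_ne_zero hq
    refine ⟨m, QEig.workSize (q + 1) a, QEig.eigC V (Fin.last q) m, ?_, ?_⟩
    · have h₁ : ((QEig.Circuit.time (QEig.eigC V (Fin.last q) m) : ℕ) : ℝ) ≤
          2 ^ m * (15 * V.time + 19) := by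
        exact_mod_cast QEig.time_eigC V (Fin.last q) m
      have h₂ : (1 : ℝ) ≤ V.time := by exact_mod_cast QEig.Circuit.one_le_time hVne
      calc _ ≤ (2 : ℝ) ^ m * (15 * V.time + 19) := h₁
        -- Since `V` takes at least one step, `15 * V.time + 19 ≤ 34 * V.time`.
        _ ≤ (2 * (L / ε₂)) * (34 * (K * (T / ε₁))) := by
            gcongr
            linarith
        _ = 68 * L * K * (T / ε₁ / ε₂) := by ring
        _ ≤ (68 * L * K + 30 * L + 4) * (T / (ε₁ * ε₂)) := by
            rw [hTε]
            gcongr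
            linarith
    · intro n I M σ θ u v C η _ hE hM hC hη hV
      refine (QEig.implementsEigenvalueEstimation_eigC hE hM hC hη hV hδ' (min_le_right _ _)
        hL hε).mono ?_
      have h₁ : (2 : ℝ) ^ m * (15 * η) ≤ (2 * (L / ε₂)) * (15 * η) := by gcongr
      have h₂ : (2 * (L / ε₂)) * (15 * η) = 30 * L * (η / ε₂) := by ring
      have h₃ : 30 * L * (η / ε₂) ≤ (68 * L * K + 30 * L + 4) * (η / ε₂) := by
        have : 0 ≤ η / ε₂ := div_nonneg hη hε₂.le
        gcongr
        have : 0 ≤ 68 * L * K := by positivity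
        linarith
      have h₄ : δ' ≤ δ := min_le_left _ _
      linarith
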